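/- **Corollary 5.11.** Let $G$ be a second-countable, locally compact, Hausdorff, étale groupoid. Here a groupoid is a small category in which every morphism is invertible, identified with its set $G$ of morphisms, with range and source maps $r,s$ onto the unit space $G^{(0)}=\{\gamma\gamma^{-1}:\gamma\in G\}\subseteq G$; $G$ carries a topology for which $r$, $s$ and composition are continuous, and étale means that $r,s:G\to G^{(0)}$ are local homeomorphisms. Suppose that $G$ is *locally contracting*: for every nonempty open $U\subseteq G^{(0)}$ there are an open set $V\subseteq U$ and an open bisection $B\subseteq G$ (that is, an open set on which $r$ and $s$ both restrict to homeomorphisms onto their images) such that $$\overline V\subseteq s(B)\quad\text{and}\quad r(B\overline V)\subsetneq V,$$ where $\overline V$ is the closure in $G^{(0)}$ and $B\overline V=\{\gamma\in B: s(\gamma)\in\overline V\}$. Let $C^*(G)$ be the full $C^*$-algebra of $G$: the completion of the $*$-algebra $C_c(G)$, with $$(f*g)(\gamma)=\sum_{r(\alpha)=r(\gamma)}f(\alpha)g(\alpha^{-1}\gamma),\qquad f^*(\gamma)=\overline{f(\gamma^{-1})},$$ in the norm $\|f\|=\sup_\pi\|\pi(f)\|$, where $\pi$ runs over the $*$-representations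 of $C_c(G)$ on Hilbert spaces that are bounded for the $I$-norm $$\|f\|_I=\sup_{u\in G^{(0)}}\max\Big\{\sum_{s(\gamma)=u}|f(\gamma)|,\ \sum_{r(\gamma)=u}|f(\gamma)|\Big\}.$$ Suppose that $C^*(G)$ is simple, that is, nonzero with no closed two-sided ideals other than $0$ and itself. Then $C^*(G)$ is purely infinite: every nonzero hereditary $C^*$-subalgebra of $C^*(G)$ contains an infinite projection, i.e. a projection $p$ for which there is $v\in C^*(G)$ with $v^*v=p$ such that $vv^*$ is a projection with $vv^*\le p$ and $vv^*\ne p$. -/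

import Mathlib

/-!
# Étale groupoids, their full C⋆-algebras, and purely infinite simple C⋆-algebras
-/

open scoped ENNReal

universe u

set_option linter.unusedSectionVars false

noncomputable section

namespace EtaleGpd

/-! ### Groupoids -/

/-- A groupoid (a small category in which every morphism is invertible), given by its set `G` of
morphisms.  An object is identified with its identity morphism, so that the source and range maps
`src`, `rng` take values in `G`.  The product `a * b` is meaningful only for composable pairs, that
is when `src a = rng b`; no law constrains its values on other pairs. -/
class AlgGroupoid (G : Type u) extends Mul G, Inv G where
  /-- the source of a morphism, as a unit -/
  src : G → G
  /-- the range of a morphism, as a unit -/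
  rng : G → G
  src_src : ∀ a, src (src a) = src a
  rng_src : ∀ a, rng (src a) = src a
  src_rng : ∀ a, src (rng a) = rng a
  rng_rng : ∀ a, rng (rng a) = rng a
  src_mul : ∀ a b, src a = rng b → src (a * b) = src b
  rng_mul : ∀ a b, src a = rng b → rng (a * b) = rng a
  mul_assoc' : ∀ a b c, src a = rng b → src b = rng c → a * b * c = a * (b * c)
  mul_src : ∀ a, a * src a = a
  rng_mul_self : ∀ a, rng a * a = a
  src_inv : ∀ a, src a⁻¹ = rng a
  rng_inv : ∀ a, rng a⁻¹ = src a
  inv_mul_self : ∀ a, a⁻¹ * a = src a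
  mul_inv_self : ∀ a, a * a⁻¹ = rng a

open AlgGroupoid

section Algebra

variable {G : Type u} [AlgGroupoid G]

theorem inv_inv' (a : G) : a⁻¹⁻¹ = a := by
  have h1 : a⁻¹⁻¹ * (a⁻¹ * a) = a⁻¹⁻¹ * a⁻¹ * a :=
    (mul_assoc' _ _ _ (src_inv _) (src_inv a)).symm
  rw [inv_mul_self, inv_mul_self, src_inv, rng_mul_self] at h1
  have h2 := mul_src (a⁻¹⁻¹)
  rw [src_inv, rng_inv] at h2
  rw [← h2, h1]

/-- `a⁻¹ (a b) = b`. -/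
theorem inv_mul_cancel' (a b : G) (h : src a = rng b) : a⁻¹ * (a * b) = b := by
  rw [← mul_assoc' _ _ _ (src_inv a) h, inv_mul_self, h, rng_mul_self]

/-- `a (a⁻¹ b) = b`. -/
theorem mul_inv_cancel' (a b : G) (h : rng a = rng b) : a * (a⁻¹ * b) = b := by
  rw [← mul_assoc' _ _ _ (rng_inv a).symm (by rw [src_inv, h]), mul_inv_self, h, rng_mul_self]

/-- `(a b) b⁻¹ = a`. -/
theorem mul_inv_cancel_right' (a b : G) (h : src a = rng b) : a * b * b⁻¹ = a := by
  rw [mul_assoc' _ _ _ h (rng_inv b).symm, mul_inv_self, ← h, mul_src]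

/-- Left translation by `b`, as a bijection from `{δ | r(δ) = s(b)}` to `{α | r(α) = r(b)}`. -/
def leftTranslate (b : G) (u v : G) (hu : rng b = u) (hv : src b = v) :
    {x : G // rng x = v} ≃ {x : G // rng x = u} where
  toFun d := ⟨b * d.1, by rw [rng_mul _ _ (hv.trans d.2.symm), hu]⟩
  invFun a := ⟨b⁻¹ * a.1, by rw [rng_mul _ _ ((src_inv b).trans (hu.trans a.2.symm)), rng_inv, hv]⟩
  left_inv d := Subtype.ext (inv_mul_cancel' _ _ (hv.trans d.2.symm))
  right_inv a := Subtype.ext (mul_inv_cancel' _ _ (hu.trans a.2.symm))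

/-- Inversion, as a bijection from `{γ | s(γ) = u}` to `{γ | r(γ) = u}`. -/
def invEquiv (u : G) : {d : G // src d = u} ≃ {a : G // rng a = u} where
  toFun d := ⟨d.1⁻¹, (rng_inv _).trans d.2⟩
  invFun a := ⟨a.1⁻¹, (src_inv _).trans a.2⟩
  left_inv d := Subtype.ext (inv_inv' _)
  right_inv a := Subtype.ext (inv_inv' _)

theorem mul_inv_rev' (a b : G) (h : src a = rng b) : (a * b)⁻¹ = b⁻¹ * a⁻¹ := by
  have hc : src (b⁻¹) = rng (a⁻¹) := by rw [src_inv, rng_inv, h]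
  have h1 : (b⁻¹ * a⁻¹) * (a * b) = src (a * b) := by
    rw [mul_assoc' _ _ _ hc (by rw [src_inv, rng_mul _ _ h]), inv_mul_cancel' _ _ h, inv_mul_self,
      src_mul _ _ h]
  have h2 := mul_inv_cancel_right' (b⁻¹ * a⁻¹) (a * b)
    (by rw [src_mul _ _ hc, src_inv, rng_mul _ _ h])
  rw [h1, ← rng_inv (a * b), rng_mul_self] at h2
  exact h2

variable (G) in
/-- The unit space `G⁽⁰⁾ = {γ γ⁻¹ : γ ∈ G}`, a subset of `G`. -/
def unitSpace : Set G := Set.range fun a : G => a * a⁻¹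

theorem rng_mem_unitSpace (a : G) : rng a ∈ unitSpace G := ⟨a, mul_inv_self a⟩

theorem src_mem_unitSpace (a : G) : src a ∈ unitSpace G :=
  ⟨a⁻¹, (mul_inv_self _).trans (rng_inv a)⟩

theorem rng_of_mem_unitSpace {a : G} (h : a ∈ unitSpace G) : rng a = a := by
  obtain ⟨b, rfl⟩ := h
  simp only [mul_inv_self, rng_rng]

theorem src_of_mem_unitSpace {a : G} (h : a ∈ unitSpace G) : src a = a := by
  obtain ⟨b, rfl⟩ := h
  simp only [mul_inv_self, src_rng]

/-- The range map as a map `G → G⁽⁰⁾`. -/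
def rngU (a : G) : unitSpace G := ⟨rng a, rng_mem_unitSpace a⟩

/-- The source map as a map `G → G⁽⁰⁾`. -/
def srcU (a : G) : unitSpace G := ⟨src a, src_mem_unitSpace a⟩

end Algebra

/-! ### Topological and étale groupoids -/

/-- A topological groupoid: the range, source and composition maps are continuous. (For étale
groupoids, continuity of inversion is a consequence, see `continuous_inv'`.) -/
class TopologicalGroupoid (G : Type u) [TopologicalSpace G] [AlgGroupoid G] : Prop where
  continuous_src : Continuous (src : G → G)
  continuous_rng : Continuous (rng : G → G)
  continuous_comp : Continuous fun p : {p : G × G // src p.1 = rng p.2} => p.1.1 * p.1.2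

/-- An étale groupoid: a topological groupoid whose range and source maps `G → G⁽⁰⁾` are local
homeomorphisms, where `G⁽⁰⁾` has the subspace topology. -/
class EtaleGroupoid (G : Type u) [TopologicalSpace G] [AlgGroupoid G] : Prop
    extends TopologicalGroupoid G where
  isLocalHomeomorph_src : IsLocalHomeomorph (srcU : G → unitSpace G)
  isLocalHomeomorph_rng : IsLocalHomeomorph (rngU : G → unitSpace G)

section Bisections

variable {G : Type u} [TopologicalSpace G] [AlgGroupoid G]

/-- A bisection: the range and source maps restrict to homeomorphisms of `B` onto their images. -/
def IsBisection (B : Set G) : Prop :=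
  Topology.IsEmbedding (fun b : B => (rngU (b : G) : unitSpace G)) ∧
    Topology.IsEmbedding (fun b : B => (srcU (b : G) : unitSpace G))

variable (G) in
/-- A groupoid is locally contracting if for every nonempty open `U ⊆ G⁽⁰⁾` there are an open
`V ⊆ U` and an open bisection `B` with `closure V ⊆ s(B)` and `r(B (closure V)) ⊊ V`.  Here
`B (closure V)` is `{γ ∈ B : s(γ) ∈ closure V}`. -/
def IsLocallyContracting : Prop :=
  ∀ U : Set (unitSpace G), IsOpen U → U.Nonempty →
    ∃ V : Set (unitSpace G), IsOpen V ∧ V ⊆ U ∧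
      ∃ B : Set G, IsOpen B ∧ IsBisection B ∧ closure V ⊆ srcU '' B ∧
        rngU '' (B ∩ srcU ⁻¹' closure V) ⊂ V

end Bisections

section Topology

variable {G : Type u} [TopologicalSpace G] [AlgGroupoid G] [EtaleGroupoid G]

open Topology Filter

theorem continuous_src : Continuous (src : G → G) := TopologicalGroupoid.continuous_src
theorem continuous_rng : Continuous (rng : G → G) := TopologicalGroupoid.continuous_rng

theorem continuousOn_mul : ContinuousOn (fun p : G × G => p.1 * p.2) {p | src p.1 = rng p.2} :=
  continuousOn_iff_continuous_domRestrict.2 TopologicalGroupoid.continuous_comp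

/-- Continuity at a point of a product of two functions that are composable nearby. -/
theorem continuousAt_mul {X : Type*} [TopologicalSpace X] {a b : X → G} {x : X}
    (ha : ContinuousAt a x) (hb : ContinuousAt b x) (h : ∀ᶠ y in 𝓝 x, src (a y) = rng (b y)) :
    ContinuousAt (fun y => a y * b y) x := by
  have hx : src (a x) = rng (b x) := h.self_of_nhds
  have := continuousOn_mul (G := G) (a x, b x) hx
  exact this.tendsto.comp (tendsto_nhdsWithin_iff.2 ⟨ha.prodMk_nhds hb, h⟩)

variable (G) in
theorem isOpen_unitSpace : IsOpen (unitSpace G) := by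
  rw [isOpen_iff_mem_nhds]
  intro x hx
  obtain ⟨e, hxe, he⟩ := EtaleGroupoid.isLocalHomeomorph_src (G := G) x
  have h1 : e.source ∩ src ⁻¹' e.source ∈ 𝓝 x :=
    (e.open_source.inter (e.open_source.preimage continuous_src)).mem_nhds
      ⟨hxe, by simpa [src_of_mem_unitSpace hx] using hxe⟩
  filter_upwards [h1] with y hy
  have h2 : y = src y := e.injOn hy.1 hy.2 (by
    rw [← he]; exact Subtype.ext (src_src y).symm)
  rw [h2]
  exact src_mem_unitSpace y

/-- The range map of an étale groupoid is a local homeomorphism from `G` to `G`. -/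
theorem isLocalHomeomorph_rng : IsLocalHomeomorph (rng : G → G) :=
  ((isOpen_unitSpace G).isOpenEmbedding_subtypeVal.isLocalHomeomorph).comp
    EtaleGroupoid.isLocalHomeomorph_rng

/-- The source map of an étale groupoid is a local homeomorphism from `G` to `G`. -/
theorem isLocalHomeomorph_src : IsLocalHomeomorph (src : G → G) :=
  ((isOpen_unitSpace G).isOpenEmbedding_subtypeVal.isLocalHomeomorph).comp
    EtaleGroupoid.isLocalHomeomorph_src

/-- Inversion in an étale groupoid is continuous. -/
theorem continuous_inv' : Continuous fun a : G => a⁻¹ := by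
  rw [continuous_iff_continuousAt]
  intro a
  obtain ⟨e, hae, he⟩ := isLocalHomeomorph_src (G := G) a⁻¹
  have hra : rng a = e a⁻¹ := by rw [← he, src_inv]
  have hta : rng a ∈ e.target := by rw [hra]; exact e.map_source hae
  have hca : e.symm (rng a) = a⁻¹ := by rw [hra]; exact e.left_inv hae
  have hc : ContinuousAt (fun b => e.symm (rng b)) a :=
    ContinuousAt.comp (f := rng) (g := e.symm) (e.continuousAt_symm hta)
      continuous_rng.continuousAt
  have hnear : ∀ᶠ b in 𝓝 a, rng b ∈ e.target :=
    continuous_rng.continuousAt.eventually (e.open_target.mem_nhds hta)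
  have hcomp : ∀ᶠ b in 𝓝 a, src (e.symm (rng b)) = rng b := by
    filter_upwards [hnear] with b hb
    rw [he]; exact e.right_inv hb
  have hm : ContinuousAt (fun b => e.symm (rng b) * b) a :=
    continuousAt_mul hc continuousAt_id hcomp
  have hunit : ∀ᶠ b in 𝓝 a, e.symm (rng b) * b ∈ unitSpace G := by
    refine hm.eventually ((isOpen_unitSpace G).mem_nhds ?_)
    simp only [hca, inv_mul_self]
    exact src_mem_unitSpace a
  refine hc.congr ?_
  filter_upwards [hcomp, hunit] with b h1 h2
  have h3 : e.symm (rng b) * b = src b := by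
    rw [← src_of_mem_unitSpace h2, src_mul _ _ h1]
  have h4 := mul_inv_cancel_right' _ _ h1
  rw [h3, ← rng_inv, rng_mul_self] at h4
  exact h4.symm

variable [T2Space G]

/-- Over a neighbourhood of a unit, a compact set is contained in the union of the graphs of
finitely many pairwise disjoint continuous local sections of the range map. -/
theorem exists_sections {K : Set G} (hK : IsCompact K) (v : G) :
    ∃ W : Set G, IsOpen W ∧ v ∈ W ∧ ∃ (T : Finset G) (σ : G → G → G),
      (∀ t ∈ T, ContinuousOn (σ t) W) ∧ (∀ w ∈ W, ∀ t ∈ T, rng (σ t w) = w) ∧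
      (∀ w ∈ W, Set.InjOn (fun t => σ t w) T) ∧
      ∀ w ∈ W, ∀ a ∈ K, rng a = w → ∃ t ∈ T, a = σ t w := by
  classical
  choose e he hre using isLocalHomeomorph_rng (G := G)
  set F : Set G := K ∩ rng ⁻¹' {v} with hF
  have hFc : IsCompact F := hK.inter_right (isClosed_singleton.preimage continuous_rng)
  have hFfin : F.Finite := by
    obtain ⟨t, htF, ht⟩ := hFc.elim_nhds_subcover (fun a => (e a).source)
      (fun a _ => (e a).open_source.mem_nhds (he a))
    refine t.finite_toSet.subset fun a ha => ?_
    obtain ⟨b, hbt, hab⟩ := Set.mem_iUnion₂.1 (ht ha)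
    have : a = b := (e b).injOn hab (he b) (by
      rw [← hre b, show rng a = v from ha.2, show rng b = v from (htF b hbt).2])
    rw [this]; exact hbt
  obtain ⟨O, hO, hdisj⟩ := hFfin.t2_separation
  let A : G → Set G := fun t => (e t).source ∩ O t
  have hAo : ∀ t, IsOpen (A t) := fun t => (e t).open_source.inter (hO t).2
  have hAt : ∀ t, t ∈ A t := fun t => ⟨he t, (hO t).1⟩
  set K' : Set G := K \ ⋃ t ∈ F, A t with hK'
  have hK'c : IsCompact K' := hK.diff (isOpen_biUnion fun t _ => hAo t)
  refine ⟨(rng '' K')ᶜ ∩ ⋂ t ∈ F, (e t) '' A t, ?_, ?_, hFfin.toFinset, fun t => (e t).symm,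
    ?_, ?_, ?_, ?_⟩
  · exact (hK'c.image continuous_rng).isClosed.isOpen_compl.inter
      (hFfin.isOpen_biInter fun t _ =>
        (e t).isOpen_image_of_subset_source (hAo t) Set.inter_subset_left)
  · refine ⟨?_, Set.mem_iInter₂.2 fun t ht => ⟨t, hAt t, ?_⟩⟩
    · rintro ⟨a, ha, hav⟩
      exact ha.2 (Set.mem_iUnion₂.2 ⟨a, ⟨ha.1, hav⟩, hAt a⟩)
    · rw [← hre t]; exact ht.2
  · intro t ht
    refine (e t).continuousOn_symm.mono fun w hw => ?_
    obtain ⟨a, ha, rfl⟩ := Set.mem_iInter₂.1 hw.2 t (by simpa using ht)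
    exact (e t).map_source ha.1
  · intro w hw t ht
    obtain ⟨a, ha, rfl⟩ := Set.mem_iInter₂.1 hw.2 t (by simpa using ht)
    change rng ((e t).symm (e t a)) = e t a
    rw [(e t).left_inv ha.1, hre t]
  · intro w hw t ht t' ht' htt
    have hO' : ∀ t ∈ F, (e t).symm w ∈ O t := by
      intro t ht
      obtain ⟨a, ha, rfl⟩ := Set.mem_iInter₂.1 hw.2 t ht
      rw [(e t).left_inv ha.1]; exact ha.2
    have h1 := hO' t (by simpa using ht)
    have h2 := hO' t' (by simpa using ht')
    simp only at htt
    rw [← htt] at h2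
    by_contra hne
    exact (hdisj (by simpa using ht) (by simpa using ht') hne).le_bot ⟨h1, h2⟩
  · intro w hw a haK haw
    have : a ∈ ⋃ t ∈ F, A t := by
      by_contra hcon
      exact hw.1 ⟨a, ⟨haK, hcon⟩, haw⟩
    obtain ⟨t, ht, hat⟩ := Set.mem_iUnion₂.1 this
    refine ⟨t, by simpa using ht, ?_⟩
    change a = (e t).symm w
    rw [← haw, hre t, (e t).left_inv hat.1]

/-- A sum over a fibre of the range map, in terms of local sections. -/
theorem tsum_fibre_eq {M : Type*} [AddCommMonoid M] [TopologicalSpace M] [T2Space M]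
    {K : Set G} {w : G} {T : Finset G} {τ : G → G}
    (h1 : ∀ t ∈ T, rng (τ t) = w) (h2 : Set.InjOn τ T)
    (h3 : ∀ a ∈ K, rng a = w → ∃ t ∈ T, a = τ t) (h : G → M) (hh : ∀ a, a ∉ K → h a = 0) :
    ∑' a : {a : G // rng a = w}, h a = ∑ t ∈ T, h (τ t) := by
  classical
  have e1 := tsum_subtype {a : G | rng a = w} h
  refine e1.trans ?_
  rw [tsum_eq_sum (s := T.image τ), Finset.sum_image h2]
  · exact Finset.sum_congr rfl fun t ht => Set.indicator_of_mem (s := {a : G | rng a = w}) (h1 t ht) h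
  · intro a ha
    by_cases haw : rng a = w
    · rw [Set.indicator_of_mem (show a ∈ {a : G | rng a = w} from haw)]
      refine hh a fun haK => ha ?_
      obtain ⟨t, ht, rfl⟩ := h3 a haK haw
      exact Finset.mem_image_of_mem _ ht
    · exact Set.indicator_of_notMem (s := {a : G | rng a = w}) haw h

theorem finite_fibre {K : Set G} (hK : IsCompact K) (v : G) : {a ∈ K | rng a = v}.Finite := by
  obtain ⟨W, -, hv, T, σ, -, -, -, h⟩ := exists_sections hK v
  refine (T.finite_toSet.image fun t => σ t v).subset ?_
  rintro a ⟨ha, hav⟩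
  obtain ⟨t, ht, rfl⟩ := h v hv a ha hav
  exact ⟨t, ht, rfl⟩

end Topology

/-! ### The convolution algebra `C_c(G)` -/

/-- The space `C_c(G)` of compactly supported continuous functions `G → ℂ`, with pointwise addition
and scalar multiplication.  (A type synonym, as it carries the convolution product below.) -/
def ConvAlg (G : Type u) [TopologicalSpace G] : Type u := CompactlySupportedContinuousMap G ℂ

namespace ConvAlg

section Basic

variable {G : Type u} [TopologicalSpace G]

instance : AddCommGroup (ConvAlg G) :=
  inferInstanceAs (AddCommGroup (CompactlySupportedContinuousMap G ℂ))
instance : Module ℂ (ConvAlg G) :=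
  inferInstanceAs (Module ℂ (CompactlySupportedContinuousMap G ℂ))
instance : FunLike (ConvAlg G) G ℂ :=
  inferInstanceAs (FunLike (CompactlySupportedContinuousMap G ℂ) G ℂ)

@[ext] theorem ext {f g : ConvAlg G} (h : ∀ x, f x = g x) : f = g := DFunLike.ext _ _ h

/-- The element of `C_c(G)` given by a continuous function with compact support. -/
def mk (f : G → ℂ) (hc : Continuous f) (hs : HasCompactSupport f) : ConvAlg G :=
  (⟨⟨f, hc⟩, hs⟩ : CompactlySupportedContinuousMap G ℂ)

@[simp] theorem mk_apply (f : G → ℂ) (hc : Continuous f) (hs : HasCompactSupport f) (x : G) :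
    mk f hc hs x = f x := rfl
@[simp] theorem zero_apply (x : G) : (0 : ConvAlg G) x = 0 := rfl
@[simp] theorem add_apply (f g : ConvAlg G) (x : G) : (f + g) x = f x + g x := rfl
@[simp] theorem smul_apply (c : ℂ) (f : ConvAlg G) (x : G) : (c • f) x = c * f x := rfl

theorem continuous (f : ConvAlg G) : Continuous f :=
  ContinuousMap.continuous (CompactlySupportedContinuousMap.toContinuousMap f)
theorem hasCompactSupport (f : ConvAlg G) : HasCompactSupport f :=
  CompactlySupportedContinuousMap.hasCompactSupport' f

end Basic

variable {G : Type u} [TopologicalSpace G] [AlgGroupoid G]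

/-- The convolution `(f * g)(γ) = ∑_{r(α) = r(γ)} f(α) g(α⁻¹γ)`.  For `f, g ∈ C_c(G)` and étale
Hausdorff `G` the sum has finitely many nonzero terms. -/
def convFun (f g : G → ℂ) (c : G) : ℂ := ∑' a : {a : G // rng a = rng c}, f a * g (a.1⁻¹ * c)

/-- The `I`-norm
`‖f‖_I = sup_{u ∈ G⁽⁰⁾} max {∑_{s(γ) = u} |f(γ)|, ∑_{r(γ) = u} |f(γ)|}`, valued in `[0,∞]`.  It is
finite when `G` is étale and Hausdorff, see `iNorm_ne_top`. -/
def iNorm (f : ConvAlg G) : ℝ≥0∞ :=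
  ⨆ v : unitSpace G, max (∑' c : {c : G // src c = v}, ‖f c‖ₑ) (∑' c : {c : G // rng c = v}, ‖f c‖ₑ)

variable [EtaleGroupoid G] [T2Space G]

theorem finite_support (f : ConvAlg G) (v : G) :
    (Function.support fun a : {a : G // rng a = v} => f a).Finite := by
  refine Set.Finite.of_finite_image (f := Subtype.val)
    ((finite_fibre f.hasCompactSupport v).subset ?_) Subtype.val_injective.injOn
  rintro _ ⟨a, ha, rfl⟩
  exact ⟨subset_tsupport _ ha, a.2⟩

open Topology Filter

theorem continuous_convFun (f g : ConvAlg G) : Continuous (convFun f g) := by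
  rw [continuous_iff_continuousAt]
  intro c
  obtain ⟨W, hW, hcW, T, σ, hσ, h1, h2, h3⟩ :=
    exists_sections f.hasCompactSupport (rng c)
  have hev : ∀ᶠ d in 𝓝 c, rng d ∈ W :=
    continuous_rng.continuousAt.eventually (hW.mem_nhds hcW)
  have hc : ContinuousAt (fun d => ∑ t ∈ T, f (σ t (rng d)) * g ((σ t (rng d))⁻¹ * d)) c := by
    refine tendsto_finsetSum _ fun t ht => ?_
    have hs : ContinuousAt (fun d => σ t (rng d)) c :=
      ContinuousAt.comp (f := rng) (g := σ t) ((hσ t ht).continuousAt (hW.mem_nhds hcW))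
        continuous_rng.continuousAt
    have hm : ContinuousAt (fun d => (σ t (rng d))⁻¹ * d) c := by
      refine continuousAt_mul (continuous_inv'.continuousAt.comp hs) continuousAt_id ?_
      filter_upwards [hev] with d hd
      rw [src_inv]; exact h1 _ hd t ht
    exact (f.continuous.continuousAt.comp hs).mul (g.continuous.continuousAt.comp hm)
  refine hc.congr ?_
  filter_upwards [hev] with d hd
  refine (tsum_fibre_eq (K := tsupport f) (h1 _ hd) (h2 _ hd) (h3 _ hd)
    (fun a => f a * g (a⁻¹ * d)) ?_).symm
  intro a ha
  rw [image_eq_zero_of_notMem_tsupport ha, zero_mul]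

theorem hasCompactSupport_convFun (f g : ConvAlg G) : HasCompactSupport (convFun f g) := by
  set S : Set (G × G) := (tsupport f ×ˢ tsupport g) ∩ {p | src p.1 = rng p.2} with hS
  have hSc : IsCompact S := (f.hasCompactSupport.prod g.hasCompactSupport).inter_right
    (isClosed_eq (continuous_src.comp continuous_fst) (continuous_rng.comp continuous_snd))
  refine HasCompactSupport.intro
    (hSc.image_of_continuousOn (continuousOn_mul.mono Set.inter_subset_right)) fun c hc => ?_
  refine (tsum_congr fun a => ?_).trans tsum_zero
  by_contra hne
  have hfa := left_ne_zero_of_mul hne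
  have hga := right_ne_zero_of_mul hne
  refine hc ⟨(a.1, a.1⁻¹ * c), ⟨⟨subset_tsupport _ hfa, subset_tsupport _ hga⟩, ?_⟩,
    mul_inv_cancel' _ _ a.2⟩
  simp only [Set.mem_ofPred_eq]
  rw [rng_mul _ _ ((src_inv _).trans a.2), rng_inv]

/-- The product of `C_c(G)` is convolution. -/
instance : Mul (ConvAlg G) :=
  ⟨fun f g => mk (convFun f g) (continuous_convFun f g) (hasCompactSupport_convFun f g)⟩

/-- The involution of `C_c(G)`: `f⋆(γ)` is the complex conjugate of `f(γ⁻¹)`. -/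
instance : Star (ConvAlg G) where
  star f := mk (fun c => star (f c⁻¹)) (f.continuous.comp continuous_inv').star (by
    refine HasCompactSupport.intro (f.hasCompactSupport.image continuous_inv') fun c hc => ?_
    rw [image_eq_zero_of_notMem_tsupport (f := f) fun h => hc ⟨_, h, inv_inv' c⟩, star_zero])

@[simp] theorem star_apply (f : ConvAlg G) (c : G) : (star f) c = star (f c⁻¹) := rfl

theorem mul_apply (f g : ConvAlg G) (c : G) :
    (f * g) c = ∑' a : {a : G // rng a = rng c}, f a * g (a.1⁻¹ * c) := rfl

theorem mul_apply' (f g : ConvAlg G) (c v : G) (h : rng c = v) :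
    (f * g) c = ∑' a : {a : G // rng a = v}, f a * g (a.1⁻¹ * c) := by subst h; rfl

theorem summable_conv (f : ConvAlg G) (v : G) (h : G → ℂ) :
    Summable fun a : {a : G // rng a = v} => f a * h a :=
  summable_of_hasFiniteSupport ((finite_support f v).subset fun _ ha => left_ne_zero_of_mul ha)

theorem mul_assoc_aux (f g h : ConvAlg G) : f * g * h = f * (g * h) := by
  ext c
  have hL : (f * g * h) c = ∑' a : {a : G // rng a = rng c}, ∑' b : {b : G // rng b = rng c},
      f b * g (b.1⁻¹ * a) * h (a.1⁻¹ * c) := by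
    rw [mul_apply]
    refine tsum_congr fun a => ?_
    rw [mul_apply' f g a.1 _ a.2, tsum_mul_right]
  have hR : (f * (g * h)) c = ∑' b : {b : G // rng b = rng c}, ∑' a : {a : G // rng a = rng c},
      f b * g (b.1⁻¹ * a) * h (a.1⁻¹ * c) := by
    rw [mul_apply]
    refine tsum_congr fun b => ?_
    have hbc : src (b.1⁻¹) = rng c := (src_inv _).trans b.2
    rw [mul_apply' g h (b.1⁻¹ * c) (src b.1) (by rw [rng_mul _ _ hbc, rng_inv]), ← tsum_mul_left,
      ← (leftTranslate b.1 (rng c) (src b.1) b.2 rfl).tsum_eq]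
    refine tsum_congr fun d => ?_
    have hd : src b.1 = rng d.1 := d.2.symm
    simp only [leftTranslate, Equiv.coe_fn_mk]
    rw [inv_mul_cancel' _ _ hd, mul_inv_rev' _ _ hd,
      mul_assoc' _ _ _ ((src_inv _).trans (hd.symm.trans (rng_inv _).symm)) hbc, mul_assoc]
  rw [hL, hR]
  refine Summable.tsum_comm ?_
  refine summable_of_hasFiniteSupport ?_
  have hfin : {a : {a : G // rng a = rng c} | h (a.1⁻¹ * c) ≠ 0}.Finite := by
    refine Set.Finite.of_finite_image
      (f := fun a : {a : G // rng a = rng c} => a.1⁻¹ * c) ?_ ?_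
    · refine ((finite_fibre (star h).hasCompactSupport (src c)).image fun a => a⁻¹).subset ?_
      rintro _ ⟨a, ha, rfl⟩
      have hac : src (a.1⁻¹) = rng c := (src_inv _).trans a.2
      refine ⟨(a.1⁻¹ * c)⁻¹, ⟨subset_tsupport _ ?_, ?_⟩, inv_inv' _⟩
      · simpa [inv_inv'] using ha
      · rw [rng_inv, src_mul _ _ hac]
    · intro a _ b _ hab
      have ha := mul_inv_cancel_right' _ _ ((src_inv a.1).trans a.2)
      have hb := mul_inv_cancel_right' _ _ ((src_inv b.1).trans b.2)
      simp only at hab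
      rw [hab, hb] at ha
      refine Subtype.ext ?_
      rw [← inv_inv' a.1, ← ha, inv_inv']
  refine ((finite_support f (rng c)).prod hfin).subset ?_
  rintro ⟨b, a⟩ hab
  have hab' : f b * g (b.1⁻¹ * a) * h (a.1⁻¹ * c) ≠ 0 := hab
  exact ⟨left_ne_zero_of_mul (left_ne_zero_of_mul hab'), right_ne_zero_of_mul hab'⟩

theorem star_mul_aux (f g : ConvAlg G) : star (f * g) = star g * star f := by
  ext c
  rw [star_apply, mul_apply' f g c⁻¹ (src c) (rng_inv c), mul_apply, tsum_star,
    ← (leftTranslate c (rng c) (src c) rfl rfl).tsum_eq]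
  refine tsum_congr fun d => ?_
  have hd : src c = rng d.1 := d.2.symm
  simp only [leftTranslate, Equiv.coe_fn_mk, star_apply]
  rw [mul_inv_rev' c d.1 hd, mul_assoc' _ _ _ ((src_inv _).trans (hd.symm.trans (rng_inv _).symm)) (src_inv c),
    inv_mul_self, star_mul]
  have h2 : (d.1⁻¹ * src c)⁻¹ = d.1 := by
    have := mul_src d.1⁻¹
    rw [src_inv, ← hd] at this
    rw [this, inv_inv']
  rw [h2]

instance : NonUnitalRing (ConvAlg G) where
  left_distrib f g h := by
    ext c
    simp only [mul_apply, add_apply, mul_add]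
    exact (summable_conv f _ fun a => g (a⁻¹ * c)).tsum_add
      (summable_conv f _ fun a => h (a⁻¹ * c))
  right_distrib f g h := by
    ext c
    simp only [mul_apply, add_apply, add_mul]
    exact (summable_conv f _ fun a => h (a⁻¹ * c)).tsum_add
      (summable_conv g _ fun a => h (a⁻¹ * c))
  zero_mul f := by ext c; simp [mul_apply]
  mul_zero f := by ext c; simp [mul_apply]
  mul_assoc := mul_assoc_aux

instance : StarRing (ConvAlg G) where
  star_involutive f := by ext c; simp [inv_inv']
  star_mul := star_mul_aux
  star_add f g := by ext c; simp

instance : StarModule ℂ (ConvAlg G) where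
  star_smul z f := by ext c; simp

instance : IsScalarTower ℂ (ConvAlg G) (ConvAlg G) where
  smul_assoc z f g := by
    ext c
    simp only [smul_eq_mul, mul_apply, smul_apply, ← tsum_mul_left, mul_assoc]

instance : SMulCommClass ℂ (ConvAlg G) (ConvAlg G) where
  smul_comm z f g := by
    ext c
    simp only [smul_eq_mul, mul_apply, smul_apply, ← tsum_mul_left, mul_left_comm]

/-! Basic properties of the `I`-norm. -/

theorem tsum_rng_le_iNorm (f : ConvAlg G) {v : G} (hv : v ∈ unitSpace G) :
    ∑' c : {c : G // rng c = v}, ‖f c‖ₑ ≤ iNorm f :=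
  (le_max_right _ _).trans (le_iSup (fun v : unitSpace G =>
    max (∑' c : {c : G // src c = v}, ‖f c‖ₑ) (∑' c : {c : G // rng c = v}, ‖f c‖ₑ)) ⟨v, hv⟩)

theorem tsum_src_eq (f : ConvAlg G) (v : G) :
    ∑' c : {c : G // src c = v}, ‖f c‖ₑ = ∑' c : {c : G // rng c = v}, ‖(star f) c‖ₑ := by
  rw [← (invEquiv v).tsum_eq]
  refine tsum_congr fun c => ?_
  simp [invEquiv, inv_inv', enorm_eq_nnnorm]

theorem iNorm_eq (f : ConvAlg G) : iNorm f = ⨆ v : unitSpace G,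
    max (∑' c : {c : G // rng c = v}, ‖(star f) c‖ₑ) (∑' c : {c : G // rng c = v}, ‖f c‖ₑ) :=
  iSup_congr fun v => by rw [tsum_src_eq]

theorem iNorm_star (f : ConvAlg G) : iNorm (star f) = iNorm f := by
  rw [iNorm_eq, iNorm_eq, star_star]
  exact iSup_congr fun v => max_comm _ _

theorem tsum_rng_mul_le (f g : ConvAlg G) (v : G) :
    ∑' c : {c : G // rng c = v}, ‖(f * g) c‖ₑ
      ≤ (∑' c : {c : G // rng c = v}, ‖f c‖ₑ) * iNorm g := by
  calc ∑' c : {c : G // rng c = v}, ‖(f * g) c‖ₑ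
      ≤ ∑' c : {c : G // rng c = v}, ∑' a : {a : G // rng a = v}, ‖f a‖ₑ * ‖g (a.1⁻¹ * c)‖ₑ := by
        refine ENNReal.tsum_le_tsum fun c => ?_
        rw [mul_apply' f g c.1 v c.2]
        refine enorm_tsum_le_tsum_enorm.trans (le_of_eq (tsum_congr fun a => ?_))
        rw [enorm_mul]
    _ = ∑' a : {a : G // rng a = v}, ‖f a‖ₑ * ∑' c : {c : G // rng c = v}, ‖g (a.1⁻¹ * c)‖ₑ := by
        rw [ENNReal.tsum_comm]
        exact tsum_congr fun a => ENNReal.tsum_mul_left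
    _ ≤ ∑' a : {a : G // rng a = v}, ‖f a‖ₑ * iNorm g := by
        refine ENNReal.tsum_le_tsum fun a => mul_le_mul_right ?_ _
        rw [← (leftTranslate a.1 v (src a.1) a.2 rfl).tsum_eq]
        refine le_trans (le_of_eq (tsum_congr fun d => ?_))
          (tsum_rng_le_iNorm g (src_mem_unitSpace a.1))
        simp only [leftTranslate, Equiv.coe_fn_mk]
        rw [inv_mul_cancel' _ _ d.2.symm]
    _ = _ := ENNReal.tsum_mul_right

theorem iNorm_mul_le (f g : ConvAlg G) : iNorm (f * g) ≤ iNorm f * iNorm g := by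
  rw [iNorm_eq (f * g)]
  refine iSup_le fun v => max_le ?_ ?_
  · rw [star_mul]
    refine (tsum_rng_mul_le _ _ _).trans ?_
    rw [iNorm_star, mul_comm, ← iNorm_star g]
    exact mul_le_mul_right (tsum_rng_le_iNorm _ v.2) _
  · exact (tsum_rng_mul_le _ _ _).trans (mul_le_mul_left (tsum_rng_le_iNorm _ v.2) _)

theorem exists_tsum_rng_le (f : ConvAlg G) :
    ∃ C : ℝ≥0∞, C ≠ ∞ ∧ ∀ v : G, ∑' c : {c : G // rng c = v}, ‖f c‖ₑ ≤ C := by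
  obtain ⟨M, hM⟩ := f.hasCompactSupport.exists_bound_of_continuous f.continuous
  have hM' : ∀ c, ‖f c‖ₑ ≤ ENNReal.ofReal M := fun c => by
    rw [← ofReal_norm]; exact ENNReal.ofReal_le_ofReal (hM c)
  have hcomp : IsCompact (rng '' tsupport f) := f.hasCompactSupport.image continuous_rng
  have key : ∃ C : ℝ≥0∞, C ≠ ∞ ∧
      ∀ v ∈ rng '' tsupport f, ∑' c : {c : G // rng c = v}, ‖f c‖ₑ ≤ C := by
    refine hcomp.induction_on (p := fun s => ∃ C : ℝ≥0∞, C ≠ ∞ ∧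
      ∀ v ∈ s, ∑' c : {c : G // rng c = v}, ‖f c‖ₑ ≤ C) ⟨0, by simp, by simp⟩ ?_ ?_ ?_
    · rintro s t hst ⟨C, hC, h⟩
      exact ⟨C, hC, fun v hv => h v (hst hv)⟩
    · rintro s t ⟨C, hC, h⟩ ⟨D, hD, h'⟩
      refine ⟨max C D, by simp [hC, hD], ?_⟩
      rintro v (hv | hv)
      · exact (h v hv).trans (le_max_left _ _)
      · exact (h' v hv).trans (le_max_right _ _)
    · intro v _
      obtain ⟨W, hW, hvW, T, σ, -, h1, h2, h3⟩ := exists_sections f.hasCompactSupport v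
      refine ⟨W, mem_nhdsWithin_of_mem_nhds (hW.mem_nhds hvW), T.card • ENNReal.ofReal M, ?_, ?_⟩
      · rw [nsmul_eq_mul]
        exact ENNReal.mul_ne_top (ENNReal.natCast_ne_top _) ENNReal.ofReal_ne_top
      · intro w hw
        rw [tsum_fibre_eq (K := tsupport f) (h1 w hw) (h2 w hw) (h3 w hw) (fun c => ‖f c‖ₑ)
          (fun a ha => by simp [image_eq_zero_of_notMem_tsupport ha])]
        exact Finset.sum_le_card_nsmul _ _ _ fun t _ => hM' _
  obtain ⟨C, hC, h⟩ := key
  refine ⟨C, hC, fun v => ?_⟩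
  by_cases hv : v ∈ rng '' tsupport f
  · exact h v hv
  · refine le_of_eq_of_le ((tsum_congr fun c => ?_).trans tsum_zero) zero_le
    rw [image_eq_zero_of_notMem_tsupport fun hc => hv ⟨_, hc, c.2⟩, enorm_zero]

theorem iNorm_ne_top (f : ConvAlg G) : iNorm f ≠ ∞ := by
  obtain ⟨C, hC, h⟩ := exists_tsum_rng_le f
  obtain ⟨D, hD, h'⟩ := exists_tsum_rng_le (star f)
  have : iNorm f ≤ max D C := by
    rw [iNorm_eq]
    exact iSup_le fun v => max_le_max (h' v) (h v)
  exact ne_top_of_le_ne_top (by simp [hC, hD]) this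

end ConvAlg

/-! ### The full groupoid C⋆-algebra -/

section Full

variable (G : Type u) [TopologicalSpace G] [AlgGroupoid G] [EtaleGroupoid G] [T2Space G]

/-- An `I`-norm-bounded `*`-representation of `C_c(G)` on a Hilbert space.  As usual, Hilbert spaces
in the universe of `G` suffice, since every cyclic representation is unitarily equivalent to one on
a completion of a quotient of `C_c(G)`. -/
structure BoundedRep where
  /-- the Hilbert space of the representation -/
  H : Type u
  [instNACG : NormedAddCommGroup H]
  [instIPS : InnerProductSpace ℂ H]
  [instComplete : CompleteSpace H]
  /-- the `*`-homomorphism into the bounded operators -/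
  π : ConvAlg G →⋆ₙₐ[ℂ] (H →L[ℂ] H)
  bounded : ∃ C : NNReal, ∀ f, ‖π f‖ₑ ≤ C * f.iNorm

attribute [instance] BoundedRep.instNACG BoundedRep.instIPS BoundedRep.instComplete

variable {G}

theorem le_of_forall_pow_le {a b C : ℝ} (hb : 0 ≤ b)
    (h : ∀ n : ℕ, a ^ 2 ^ n ≤ C * b ^ 2 ^ n) : a ≤ b := by
  by_contra! hlt
  rcases hb.eq_or_lt with rfl | hb
  · have := h 0
    simp at this
    linarith
  · obtain ⟨n, hn⟩ := pow_unbounded_of_one_lt C ((one_lt_div hb).2 hlt)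
    have h1 : C < (a / b) ^ 2 ^ n :=
      hn.trans_le (pow_le_pow_right₀ ((one_lt_div hb).2 hlt).le Nat.lt_two_pow_self.le)
    rw [div_pow, lt_div_iff₀ (pow_pos hb _)] at h1
    exact absurd (h n) (not_le.2 h1)

/-- An `I`-norm-bounded `*`-representation is automatically contractive for the `I`-norm. -/
theorem BoundedRep.norm_le (ρ : BoundedRep G) (f : ConvAlg G) : ‖ρ.π f‖ ≤ f.iNorm.toReal := by
  obtain ⟨C, hC⟩ := ρ.bounded
  have hC' : ∀ h : ConvAlg G, ‖ρ.π h‖ ≤ C * h.iNorm.toReal := fun h => by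
    have := ENNReal.toReal_mono (ENNReal.mul_ne_top ENNReal.coe_ne_top h.iNorm_ne_top) (hC h)
    simpa using this
  have hmul : ∀ h k : ConvAlg G, (h * k).iNorm.toReal ≤ h.iNorm.toReal * k.iNorm.toReal :=
    fun h k => by
      rw [← ENNReal.toReal_mul]
      exact ENNReal.toReal_mono (ENNReal.mul_ne_top h.iNorm_ne_top k.iNorm_ne_top)
        (ConvAlg.iNorm_mul_le h k)
  have hpow : ∀ (n : ℕ) (h : ConvAlg G), star h = h →
      ‖ρ.π h‖ ^ 2 ^ n ≤ C * h.iNorm.toReal ^ 2 ^ n := by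
    intro n
    induction n with
    | zero => intro h _; simpa using hC' h
    | succ n ih =>
      intro h hh
      have h1 := ih (h * h) (by rw [star_mul, hh])
      have h2 : ‖ρ.π (h * h)‖ = ‖ρ.π h‖ ^ 2 := by
        have := CStarRing.norm_star_mul_self (x := ρ.π h)
        rw [← map_star, hh, ← map_mul] at this
        rw [this, sq]
      rw [h2, ← pow_mul, ← pow_succ'] at h1
      refine h1.trans (mul_le_mul_of_nonneg_left ?_ C.2)
      calc (h * h).iNorm.toReal ^ 2 ^ n ≤ (h.iNorm.toReal ^ 2) ^ 2 ^ n :=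
            pow_le_pow_left₀ ENNReal.toReal_nonneg ((hmul h h).trans (sq _).symm.le) _
        _ = _ := by rw [← pow_mul, ← pow_succ']
  have h1 : ‖ρ.π (star f * f)‖ ≤ (star f * f).iNorm.toReal :=
    le_of_forall_pow_le ENNReal.toReal_nonneg
      fun n => hpow n _ (by rw [star_mul, star_star])
  have h2 : ‖ρ.π (star f * f)‖ = ‖ρ.π f‖ ^ 2 := by
    rw [map_mul, map_star, CStarRing.norm_star_mul_self, sq]
  refine le_of_sq_le_sq ?_ ENNReal.toReal_nonneg
  rw [← h2]
  refine h1.trans ((hmul _ _).trans ?_)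
  rw [ConvAlg.iNorm_star, sq]

/-- The full norm on `C_c(G)`: the supremum of `‖π(f)‖` over the `I`-norm-bounded
`*`-representations `π` of `C_c(G)`. -/
def fullNorm (f : ConvAlg G) : ℝ := ⨆ ρ : BoundedRep G, ‖ρ.π f‖

theorem bddAbove_norm (f : ConvAlg G) : BddAbove (Set.range fun ρ : BoundedRep G => ‖ρ.π f‖) :=
  ⟨f.iNorm.toReal, by rintro _ ⟨ρ, rfl⟩; exact ρ.norm_le f⟩

variable (G) in
/-- The product of all `I`-norm-bounded `*`-representations of `C_c(G)`, with values in the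
`ℓ^∞`-product of the algebras of bounded operators. -/
def universalRep : ConvAlg G →⋆ₙₐ[ℂ] lp (fun ρ : BoundedRep G => ρ.H →L[ℂ] ρ.H) ∞ where
  toFun f := ⟨fun ρ => ρ.π f, memℓp_infty (bddAbove_norm f)⟩
  map_smul' z f := by ext1; funext ρ; exact map_smul ρ.π z f
  map_zero' := by ext1; funext ρ; exact map_zero ρ.π
  map_add' f g := by ext1; funext ρ; exact map_add ρ.π f g
  map_mul' f g := by ext1; funext ρ; exact map_mul ρ.π f g
  map_star' f := by ext1; funext ρ; exact map_star ρ.π f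

/-- The norm of the universal representation is the full norm. -/
theorem norm_universalRep (f : ConvAlg G) : ‖universalRep G f‖ = fullNorm f :=
  lp.norm_eq_ciSup _

variable (G) in
/-- The full C⋆-algebra `C⋆(G)`: the completion of `C_c(G)` in the full norm, realised as the
closure of the image of `C_c(G)` in the (complete) `ℓ^∞`-product of all `I`-norm-bounded
`*`-representations, on which the norm is the full norm.  See `norm_toFullCStar` and
`denseRange_toFullCStar`. -/
def FullCStar : Type (u + 1) :=
  (NonUnitalStarAlgHom.range (universalRep G)).topologicalClosure

instance : NonUnitalCStarAlgebra (FullCStar G) :=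
  NonUnitalStarSubalgebra.nonUnitalCStarAlgebra
    (NonUnitalStarAlgHom.range (universalRep G)).topologicalClosure
    (h_closed := NonUnitalStarSubalgebra.isClosed_topologicalClosure _)

/-- The usual order of a C⋆-algebra. -/
instance : PartialOrder (FullCStar G) := CStarAlgebra.spectralOrder _
instance : StarOrderedRing (FullCStar G) := CStarAlgebra.spectralOrderedRing _

/-- The canonical map `C_c(G) → C⋆(G)`. -/
def toFullCStar : ConvAlg G →⋆ₙₐ[ℂ] FullCStar G where
  toFun f := ⟨universalRep G f, NonUnitalStarSubalgebra.le_topologicalClosure _ ⟨f, rfl⟩⟩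
  map_smul' z f := Subtype.ext ((universalRep G).map_smul' z f)
  map_zero' := Subtype.ext (map_zero (universalRep G))
  map_add' f g := Subtype.ext (map_add (universalRep G) f g)
  map_mul' f g := Subtype.ext (map_mul (universalRep G) f g)
  map_star' f := Subtype.ext (map_star (universalRep G) f)

/-- The canonical map `C_c(G) → C⋆(G)` is isometric for the full norm. -/
theorem norm_toFullCStar (f : ConvAlg G) : ‖toFullCStar f‖ = fullNorm f :=
  norm_universalRep f

/-- The image of `C_c(G)` in `C⋆(G)` is dense. -/
theorem denseRange_toFullCStar : DenseRange (toFullCStar : ConvAlg G → FullCStar G) := by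
  intro x
  refine closure_subtype.2 (closure_mono ?_ x.2)
  rintro _ ⟨f, rfl⟩
  exact ⟨_, ⟨f, rfl⟩, rfl⟩

end Full

/-! ### Simple and purely infinite C⋆-algebras -/

section CStar

variable {A : Type*} [NonUnitalCStarAlgebra A]

variable (A) in
/-- A C⋆-algebra is simple if it is nonzero and its only closed two-sided ideals are `0` and the
whole algebra. -/
def IsSimpleCStar : Prop :=
  Nontrivial A ∧ ∀ I : TwoSidedIdeal A, IsClosed (I : Set A) → I = ⊥ ∨ I = ⊤

/-- A hereditary C⋆-subalgebra: a norm-closed `*`-subalgebra `B` such that `0 ≤ a ≤ b` and `b ∈ B`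
imply `a ∈ B`. -/
def IsHereditary [PartialOrder A] [StarOrderedRing A] (B : NonUnitalStarSubalgebra ℂ A) : Prop :=
  IsClosed (B : Set A) ∧ ∀ a b : A, 0 ≤ a → a ≤ b → b ∈ B → a ∈ B

/-- A projection `p` is infinite if it is Murray-von Neumann equivalent to a proper subprojection:
there is `v` with `v⋆v = p`, and `vv⋆` is a projection with `vv⋆ ≤ p` and `vv⋆ ≠ p`. -/
def IsInfiniteProjection [PartialOrder A] [StarOrderedRing A] (p : A) : Prop :=
  IsStarProjection p ∧ ∃ v q : A, IsStarProjection q ∧ star v * v = p ∧ v * star v = q ∧ q < p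

variable (A) in
/-- A (simple) C⋆-algebra is purely infinite if every nonzero hereditary C⋆-subalgebra contains an
infinite projection. -/
def IsPurelyInfinite [PartialOrder A] [StarOrderedRing A] : Prop :=
  ∀ B : NonUnitalStarSubalgebra ℂ A, IsHereditary B → B ≠ ⊥ → ∃ p ∈ B, IsInfiniteProjection p

end CStar

end EtaleGpd

end

/-!
# Pure infiniteness of simple C⋆-algebras of locally contracting étale groupoids
-/

/-! Write `A` for the full C⋆-algebra. No conditional expectation is used: simplicity makes every
nonzero `ℓ²`-representation faithful, and two such representations replace it. Both come from
actions of `G` on sets (`GpdAction.rep`). The regular representation on `ℓ²(G)` embeds `C_c(G)` in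
`A`, and a nonzero `b` of a hereditary subalgebra `B` must move some point mass `δ_γ`. The
corresponding vector functional sends `f ∈ C_c(G)` to `f (rng γ)` and sends `b⋆b` to some `η > 0`
(`exists_unit_pos`). The representation on `ℓ²(G⁽⁰⁾)` does not distinguish an isotropy arrow from
its unit, so faithfulness forbids nonempty open sets of non-unit isotropy (`exists_src_ne_rng`).

Approximate `b⋆b` within `η/4` by `f ∈ C_c(G)`. Then `f` is within `η/2` of `η` on an open set of
units, and this set shrinks to a nonempty open `W` such that `f` vanishes on every non-unit arrow
with both ends in `W` (`exists_open_subset_support`). If `e` is a function supported in `W`, then `e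
* f * e` is a function on units, close to `η e²`. For an infinite projection `p` with `e p = p`, the
element `p b⋆b p` is therefore within less than `η` of `η p`, hence invertible in the corner of `p`.
An inverse square root there carries `p` to an equivalent projection in `B`
(`IsHereditary.exists_isInfiniteProjection`).

It remains to find `p` over `W`. A contracting bisection gives `x` and a bump function `k` for which
`x + (1 - k)` is an isometry; its defect projection dominates all functions supported in some
smaller nonempty open `D` (`IsLocallyContracting.exists_isometry`). Take `p` to be the defect of
such an isometry over `W`, and apply the construction again over `D`: now the corner of `p` contains
a nonunitary isometry, up to adding an identity. By simplicity `p` is a finite sum `∑ c⋆ e c`, with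
`e` here the defect of the second isometry `S`. The pairwise orthogonal copies of `e` under powers
of `S` turn this sum into an equivalence of `p` with a proper subprojection
(`isInfiniteProjection_of_isometry`).

Since `A` need not have a unit, an isometry `1 + y` is encoded by `star y * y + y + star y = 0`. -/

noncomputable section

namespace EtaleGpd

/-! ### Corners, isometries and infinite projections in C⋆-algebras. -/

section CStarLemmas

variable {A : Type*} [NonUnitalCStarAlgebra A]

section InvSqrt
variable [PartialOrder A] [StarOrderedRing A]

open scoped CStarAlgebra in
/-- If `s` lives in the corner of the projection `p` and is bounded below there, then it has an
inverse square root in this corner. -/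
theorem exists_corner_inv_sqrt {p s w : A} {δ : ℝ} (hp : IsStarProjection p)
    (hps : p * s = s) (hsp : s * p = s) (hw : IsSelfAdjoint w) (hwδ : ‖w‖ < δ)
    (h : 0 ≤ s - δ • p - w) :
    ∃ t : A, IsSelfAdjoint t ∧ p * t = t ∧ t * p = t ∧ t * s * t = p := by
  have hpU : IsStarProjection (p : Unitization ℂ A) :=
    hp.map (Unitization.inrNonUnitalStarAlgHom ℂ A)
  -- Filling the complementary corner with `δ` makes `s` strictly positive: `S` is `s - δp - w ≥ 0`
  -- plus `w + δ ≥ δ - ‖w‖ > 0`.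
  set S : Unitization ℂ A := (s : Unitization ℂ A) + (δ : ℝ) • (1 - (p : Unitization ℂ A)) with hS
  have h1 : (0 : Unitization ℂ A) ≤ ((s - δ • p - w : A) : Unitization ℂ A) :=
    Unitization.inr_nonneg_iff.2 h
  have hwU : IsSelfAdjoint (w : Unitization ℂ A) := hw.map (Unitization.inrNonUnitalStarAlgHom ℂ A)
  have h2 := hwU.neg_algebraMap_norm_le_self
  have h3 : algebraMap ℝ (Unitization ℂ A) (δ - ‖w‖) ≤ S := by
    have : S = ((s - δ • p - w : A) : Unitization ℂ A) + (w + algebraMap ℝ (Unitization ℂ A) δ) := by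
      simp only [hS, Unitization.inr_sub, Unitization.inr_smul, Algebra.algebraMap_eq_smul_one,
        smul_sub]
      abel
    rw [this, map_sub, sub_eq_neg_add]
    rw [Unitization.norm_inr] at h2
    exact (add_le_add_left h2 _).trans (le_add_of_nonneg_left h1)
  have hSp : IsStrictlyPositive S := by
    have hpos : 0 < δ - ‖w‖ := sub_pos.2 hwδ
    refine IsStrictlyPositive.of_le ?_ h3
    exact isStrictlyPositive_algebraMap hpos
  have hpp : (p : Unitization ℂ A) * p = p := hpU.isIdempotentElem
  have hcomm : Commute S (p : Unitization ℂ A) := by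
    have e1 : (s : Unitization ℂ A) * p = s := by rw [← Unitization.inr_mul, hsp]
    have e2 : (p : Unitization ℂ A) * s = s := by rw [← Unitization.inr_mul, hps]
    simp [Commute, SemiconjBy, hS, add_mul, mul_add, sub_mul, mul_sub, e1, e2, hpp]
  set R : Unitization ℂ A := S ^ (-(1/2) : ℝ) with hR
  have hRc : Commute R (p : Unitization ℂ A) := by
    exact hcomm.cfc_nnreal _
  have hRR : R * S * R = 1 := by
    rw [mul_assoc]
    nth_rw 1 [← CFC.rpow_one S]
    rw [hR, ← CFC.rpow_add hSp.isUnit, ← CFC.rpow_add hSp.isUnit]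
    norm_num
    exact CFC.rpow_zero S
  have hSs : (p : Unitization ℂ A) * S = s := by
    rw [hS, mul_add, ← Unitization.inr_mul, hps, mul_smul_comm, mul_sub, hpp, mul_one, sub_self,
      smul_zero, add_zero]
  -- `A` is an ideal of its unitization, so the compression of `R = S^(-1/2)` by `p` already lies in
  -- `A`.
  obtain ⟨t, ht⟩ : ∃ t : A, (t : Unitization ℂ A) = R * p := by
    refine ⟨(R * p).snd, Unitization.ext ?_ rfl⟩
    simp
  have hRsa : IsSelfAdjoint R := (CFC.rpow_nonneg (a := S)).isSelfAdjoint
  refine ⟨t, ?_, ?_, ?_, ?_⟩ <;> apply Unitization.inr_injective (R := ℂ)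
  · rw [Unitization.inr_star, ht, star_mul, hpU.isSelfAdjoint.star_eq, hRsa.star_eq, hRc.eq]
  · rw [Unitization.inr_mul, ht, hRc.eq, ← mul_assoc, hpp]
  · rw [Unitization.inr_mul, ht, mul_assoc, hpp]
  · rw [Unitization.inr_mul, Unitization.inr_mul, ht]
    calc R * p * s * (R * p) = R * (p * S) * (R * p) := by
          rw [hSs, mul_assoc R, ← Unitization.inr_mul, hps]
      _ = R * S * R * p := by
          rw [← hcomm.eq, hRc.eq]
          simp only [mul_assoc]
          rw [← mul_assoc (p : Unitization ℂ A) p, hpp, ← hRc.eq]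
      _ = p := by rw [hRR, one_mul]

end InvSqrt

/-! ### Isometries `1 + y` and their defect projections. -/

section Defect

/-- The defect projection `1 - (1 + y)(1 + y)⋆` of an isometry `1 + y`. -/
def defect (y : A) : A := -(y + star y + y * star y)

variable {y : A} (hy : star y * y + y + star y = 0)
include hy

theorem star_mul_self_of_isometry : star y * y = -y - star y := by
  rw [← sub_eq_zero, ← hy]; abel

/-- The defect annihilates the range of the isometry: `(1 - SS⋆)S = 0` for `S = 1 + y`. -/
theorem defect_mul_self_of_isometry : defect y * y = -defect y := by
  have h := star_mul_self_of_isometry hy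
  simp only [defect, neg_mul, add_mul, mul_assoc, h, mul_sub, mul_neg]
  abel

theorem isStarProjection_defect : IsStarProjection (defect y) where
  isSelfAdjoint := by
    simp only [IsSelfAdjoint, defect, star_neg, star_add, star_mul, star_star]
    abel
  isIdempotentElem := by
    have h := defect_mul_self_of_isometry hy
    change defect y * defect y = defect y
    nth_rw 2 [defect]
    rw [mul_neg, mul_add, mul_add, ← mul_assoc, h, neg_mul]
    abel

end Defect

/-- If `1 + y` is an isometry, then `(1 + y) a` and `a` have the same absolute value. -/
theorem star_mul_self_isometry_mul {y : A} (hy : star y * y + y + star y = 0) (a : A) :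
    star (a + y * a) * (a + y * a) = star a * a := by
  have : star (a + y * a) * (a + y * a) = star a * a + star a * (star y * y + y + star y) * a := by
    simp only [star_add, star_mul]
    noncomm_ring
  rw [this, hy, mul_zero, zero_mul, add_zero]

/-! ### Infinite projections in simple C⋆-algebras. -/

section Infinite

/-- In a simple C⋆-algebra finite sums of products `a p b` with fixed `p ≠ 0` are dense. -/
theorem mem_closure_mul_mul (hA : IsSimpleCStar A) {p : A} (hp : p * p * p ≠ 0) (x : A) :
    x ∈ closure (AddSubgroup.closure {z : A | ∃ a b, z = a * p * b} : Set A) := by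
  set J := (AddSubgroup.closure {z : A | ∃ a b, z = a * p * b}).topologicalClosure with hJ
  have hmul : ∀ x : A, (∀ z ∈ AddSubgroup.closure {z : A | ∃ a b, z = a * p * b},
      x * z ∈ J ∧ z * x ∈ J) := by
    intro x z hz
    induction hz using AddSubgroup.closure_induction with
    | mem z hz =>
      obtain ⟨a, b, rfl⟩ := hz
      exact ⟨AddSubgroup.le_topologicalClosure _ (AddSubgroup.subset_closure
          ⟨x * a, b, by simp only [mul_assoc]⟩),
        AddSubgroup.le_topologicalClosure _ (AddSubgroup.subset_closure
          ⟨a, b * x, by simp only [mul_assoc]⟩)⟩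
    | zero => simp
    | add z w _ _ h1 h2 =>
      rw [mul_add, add_mul]
      exact ⟨J.add_mem h1.1 h2.1, J.add_mem h1.2 h2.2⟩
    | neg z _ h =>
      rw [mul_neg, neg_mul]
      exact ⟨J.neg_mem h.1, J.neg_mem h.2⟩
  have hcl : IsClosed (J : Set A) := AddSubgroup.isClosed_topologicalClosure _
  have hmul' : ∀ x : A, ∀ z ∈ J, x * z ∈ J ∧ z * x ∈ J := by
    intro x z hz
    refine closure_minimal (s := (AddSubgroup.closure {z : A | ∃ a b, z = a * p * b} : Set A))
      (t := {z | x * z ∈ J ∧ z * x ∈ J}) (fun z hz => hmul x z hz) ?_ hz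
    exact (hcl.preimage (continuous_const_mul x)).inter (hcl.preimage (continuous_mul_const x))
  let I : TwoSidedIdeal A := TwoSidedIdeal.mk' (J : Set A) J.zero_mem J.add_mem J.neg_mem
    (fun {x y} h => (hmul' x y h).1) (fun {x y} h => (hmul' y x h).2)
  have hI : (I : Set A) = J := TwoSidedIdeal.coe_mk' ..
  -- Without a unit `p` need not visibly have the form `a * p * b`, so `p * p * p` is the element
  -- that excludes the zero ideal.
  rcases hA.2 I (hI ▸ hcl) with h | h
  · exfalso
    have : p * p * p ∈ (I : Set A) := by
      rw [hI]
      exact AddSubgroup.le_topologicalClosure _ (AddSubgroup.subset_closure ⟨p, p, rfl⟩)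
    rw [h] at this
    exact hp (by simpa using this)
  · have : x ∈ (I : Set A) := by rw [h]; trivial
    rw [hI] at this
    exact this

variable [PartialOrder A] [StarOrderedRing A]

/-- In a simple C⋆-algebra every projection is a finite sum `∑ c⋆ e c`, for any given projection
`e ≠ 0`. -/
theorem exists_list_sum_eq (hA : IsSimpleCStar A) {e p : A} (he : IsStarProjection e)
    (he0 : e ≠ 0) (hp : IsStarProjection p) :
    ∃ l : List A, (l.map fun c => star c * e * c).sum = p := by
  have hee : e * e = e := he.isIdempotentElem
  have hpp : p * p = p := hp.isIdempotentElem
  have hcl := mem_closure_mul_mul hA (p := e) (by rwa [hee, hee]) p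
  obtain ⟨m, hm, hpm⟩ := Metric.mem_closure_iff.1 hcl 1 one_pos
  -- Expanding `(a⋆ ∓ b)⋆ e (a⋆ ∓ b) ≥ 0` bounds `±(aeb + (aeb)⋆)` by `aea⋆ + b⋆eb`. Both signs are
  -- carried along so that the induction survives negation.
  have key : ∃ l : List A, m + star m ≤ (l.map fun c => star c * e * c).sum ∧
      -(m + star m) ≤ (l.map fun c => star c * e * c).sum := by
    clear hpm hcl
    induction hm using AddSubgroup.closure_induction with
    | mem z hz =>
      obtain ⟨a, b, rfl⟩ := hz
      refine ⟨[star a, b], ?_, ?_⟩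
      · have := star_mul_self_nonneg (e * (star a - b))
        rw [← sub_nonneg]
        convert this using 1
        simp only [star_mul, star_sub, star_star, he.isSelfAdjoint.star_eq, List.map_cons,
          List.map_nil, List.sum_cons, List.sum_nil]
        rw [mul_assoc _ e (e * _), ← mul_assoc e e, hee]
        noncomm_ring
      · have := star_mul_self_nonneg (e * (star a + b))
        rw [← sub_nonneg]
        convert this using 1
        simp only [star_mul, star_add, star_star, he.isSelfAdjoint.star_eq, List.map_cons,
          List.map_nil, List.sum_cons, List.sum_nil]
        rw [mul_assoc _ e (e * _), ← mul_assoc e e, hee]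
        noncomm_ring
    | zero => exact ⟨[], by simp, by simp⟩
    | add z w _ _ h1 h2 =>
      obtain ⟨l, hl, hl'⟩ := h1
      obtain ⟨k, hk, hk'⟩ := h2
      refine ⟨l ++ k, ?_, ?_⟩ <;> rw [List.map_append, List.sum_append]
      · refine le_trans (le_of_eq ?_) (add_le_add hl hk)
        rw [star_add]; abel
      · refine le_trans (le_of_eq ?_) (add_le_add hl' hk')
        rw [star_add]; abel
    | neg z _ h =>
      obtain ⟨l, hl, hl'⟩ := h
      refine ⟨l, ?_, ?_⟩
      · refine le_trans (le_of_eq ?_) hl'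
        rw [star_neg]; abel
      · refine le_trans (le_of_eq ?_) hl
        rw [star_neg]; abel
  obtain ⟨l, hl, -⟩ := key
  have hconj : ∀ (l : List A) (d : A), star d * (l.map fun c => star c * e * c).sum * d =
      ((l.map (· * d)).map fun c => star c * e * c).sum := by
    intro l d
    induction l with
    | nil => simp
    | cons c l ih =>
      simp only [List.map_cons, List.sum_cons, mul_add, add_mul, ih, star_mul]
      simp only [mul_assoc]
  set s := (l.map fun c => star c * e * c).sum with hs
  -- As `‖m - p‖ < 1`, the compression of `m + m⋆` is `2p + w` with `‖w‖ < 2`. It lies below `p * s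
  -- * p`, which is thus invertible in the corner of `p`.
  obtain ⟨t, hts, -, -, htt⟩ := exists_corner_inv_sqrt (s := p * s * p)
    (w := p * (m + star m - (2 : ℝ) • p) * p) (δ := 2) hp
    (by rw [← mul_assoc, ← mul_assoc, hpp]) (by rw [mul_assoc, hpp])
    (by
      simp only [IsSelfAdjoint, star_mul, star_sub, star_add, star_star, star_smul, star_trivial,
        hp.isSelfAdjoint.star_eq, mul_assoc, add_comm])
    (by
      have h1 : m + star m - (2 : ℝ) • p = (m - p) + star (m - p) := by
        rw [star_sub, hp.isSelfAdjoint.star_eq, two_smul]; abel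
      have h2 : ‖m - p‖ < 1 := by rwa [← dist_eq_norm, dist_comm]
      have h3 : ‖m + star m - (2 : ℝ) • p‖ < 2 := by
        rw [h1]
        refine (norm_add_le _ _).trans_lt ?_
        rw [norm_star]; linarith
      have h4 : ‖p‖ ≤ 1 := hp.norm_le
      refine lt_of_le_of_lt ?_ h3
      refine (norm_mul_le _ _).trans ((mul_le_of_le_one_right (norm_nonneg _) h4).trans ?_)
      exact (norm_mul_le _ _).trans (mul_le_of_le_one_left (norm_nonneg _) h4))
    (by
      have := star_left_conjugate_nonneg (sub_nonneg.2 hl) p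
      rw [hp.isSelfAdjoint.star_eq] at this
      convert this using 1
      simp only [mul_sub, sub_mul, mul_smul_comm, smul_mul_assoc, hpp]
      abel)
  refine ⟨l.map (· * (p * t)), ?_⟩
  rw [← hconj, star_mul, hts.star_eq, hp.isSelfAdjoint.star_eq, ← hs]
  refine Eq.trans ?_ htt
  simp only [mul_assoc]

/-- A projection `p` of a simple C⋆-algebra dominating the range of a nonunitary isometry minus
identity is infinite. -/
theorem isInfiniteProjection_of_isometry (hA : IsSimpleCStar A) {p y : A}
    (hp : IsStarProjection p) (hy : star y * y + y + star y = 0) (hy0 : defect y ≠ 0)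
    (hpy : p * y = y) (hpy' : p * star y = star y) : IsInfiniteProjection p := by
  have he := isStarProjection_defect hy
  have hey := defect_mul_self_of_isometry hy
  set e := defect y with hedef
  have hee : e * e = e := he.isIdempotentElem
  have hes : star e = e := he.isSelfAdjoint
  have hpe : p * e = e := by
    rw [hedef, defect, mul_neg, mul_add, mul_add, ← mul_assoc, hpy, hpy']
  obtain ⟨l, hl⟩ := exists_list_sum_eq hA he hy0 hp
  -- With `S = 1 + y`, the witness is `w = ∑ Sⁱ e cᵢ`, built as `e c + S w`. The cross terms vanish
  -- because `e S = 0`, and `S` preserves `w⋆w`.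
  have key : ∀ l : List A, ∃ w : A, star w * w = (l.map fun c => star c * e * c).sum ∧
      p * w = w := by
    intro l
    induction l with
    | nil => exact ⟨0, by simp, by simp⟩
    | cons c l ih =>
      obtain ⟨w, hw, hpw⟩ := ih
      have h0 : e * (w + y * w) = 0 := by
        rw [mul_add, ← mul_assoc, hey, neg_mul, add_neg_cancel]
      refine ⟨e * c + (w + y * w), ?_, ?_⟩
      · rw [List.map_cons, List.sum_cons, ← hw, ← star_mul_self_isometry_mul hy w, star_add,
          add_mul, mul_add (star (e * c)), mul_add (star (w + y * w))]
        have h1 : star (e * c) * (w + y * w) = 0 := by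
          rw [star_mul, hes, mul_assoc, h0, mul_zero]
        have h2 : star (w + y * w) * (e * c) = 0 := by
          rw [← star_star (star (w + y * w) * (e * c)), star_mul, star_star, h1, star_zero]
        rw [h1, h2, add_zero, zero_add, star_mul, hes, mul_assoc (star c) e (e * c),
          ← mul_assoc e e c, hee, mul_assoc]
      · rw [mul_add, mul_add, ← mul_assoc, ← mul_assoc, hpe, hpw, hpy]
  obtain ⟨w, hw, hpw⟩ := key l
  -- One more application of `S` leaves the defect unused: `e v = 0`, so `v v⋆ = p` would force `e =
  -- e p = 0`.
  set v := w + y * w with hv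
  have hvv : star v * v = p := by rw [hv, star_mul_self_isometry_mul hy, hw, hl]
  have hpv : p * v = v := by rw [hv, mul_add, ← mul_assoc, hpw, hpy]
  have hev : e * v = 0 := by rw [hv, mul_add, ← mul_assoc, hey, neg_mul, add_neg_cancel]
  have hvp : v * p = v := by
    rw [← sub_eq_zero, ← CStarRing.star_mul_self_eq_zero_iff]
    rw [star_sub, star_mul, hp.isSelfAdjoint.star_eq, sub_mul, mul_sub, mul_sub, hvv, mul_assoc,
      ← mul_assoc (star v), hvv, hp.isIdempotentElem.eq, mul_assoc, hvv, hp.isIdempotentElem.eq]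
    simp
  have hq : IsStarProjection (v * star v) :=
    ⟨by change v * star v * (v * star v) = _; rw [mul_assoc, ← mul_assoc (star v), hvv, ← mul_assoc, hvp],
      by rw [IsSelfAdjoint, star_mul, star_star]⟩
  refine ⟨hp, v, v * star v, hq, hvv, rfl, lt_of_le_of_ne ?_ ?_⟩
  · rw [hq.le_iff_mul_eq_right hp, ← mul_assoc, hpv]
  · intro h
    apply hy0
    rw [← he.isSelfAdjoint.star_eq, ← hpe, star_mul, hes, hp.isSelfAdjoint.star_eq, ← h,
      ← mul_assoc, hev, zero_mul]

/-- If an element of a hereditary subalgebra is bounded below on an infinite projection, then the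
subalgebra contains an infinite projection. -/
theorem IsHereditary.exists_isInfiniteProjection {B : NonUnitalStarSubalgebra ℂ A}
    (hB : IsHereditary B) {b p : A} (hb : b ∈ B) (hp : IsInfiniteProjection p) {η : ℝ}
    (h : ‖p * (star b * b) * p - η • p‖ < η) : ∃ q ∈ B, IsInfiniteProjection q := by
  obtain ⟨hpp, v, r, hr, hvp, hvr, hrp⟩ := hp
  have hp2 : p * p = p := hpp.isIdempotentElem
  have hps : star p = p := hpp.isSelfAdjoint
  -- Taking `w` to be the whole error `s - ηp` makes the required positivity `0 ≤ 0`.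
  obtain ⟨t, hts, hpt, htp, htt⟩ := exists_corner_inv_sqrt (s := p * (star b * b) * p)
    (w := p * (star b * b) * p - η • p) (δ := η) hpp
    (by rw [← mul_assoc, ← mul_assoc, hp2]) (by rw [mul_assoc, hp2])
    (by simp only [IsSelfAdjoint, star_sub, star_mul, star_star, star_smul, star_trivial, hps,
          mul_assoc]) h (by simp)
  have htt' : t * (star b * b) * t = p := by
    rw [← htt]
    nth_rw 1 [← htp]
    nth_rw 2 [← hpt]
    simp only [mul_assoc]
  -- `z` is a partial isometry with `z z⋆ = p`. The other projection `z⋆z = b t² b⋆ ≤ ‖t²‖ b b⋆`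
  -- falls into `B` by heredity, and conjugation by `z` transports `v` and `r`.
  set z := t * star b with hz
  have hzz : z * star z = p := by
    rw [hz, star_mul, star_star, hts.star_eq, ← htt']
    simp only [mul_assoc]
  have hpz : p * z = z := by rw [hz, ← mul_assoc, hpt]
  have hzp : star z * p = star z := by
    rw [← hps, ← star_mul, hpz]
  have hmem : star z * z ∈ B := by
    have h1 : star z * z ≤ ‖t * t‖ • (b * star b) := by
      have h2 := CStarAlgebra.star_right_conjugate_le_norm_smul (a := b) (b := t * t) (hb := by
        rw [IsSelfAdjoint, star_mul, hts.star_eq])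
      refine le_trans (le_of_eq ?_) h2
      rw [hz, star_mul, star_star, hts.star_eq]
      simp only [mul_assoc]
    refine hB.2 _ _ (star_mul_self_nonneg z) h1 ?_
    have : (‖t * t‖ : ℂ) • (b * star b) ∈ B :=
      SMulMemClass.smul_mem _ (mul_mem hb (star_mem hb))
    rwa [Complex.coe_smul] at this
  have hproj : ∀ e : A, IsStarProjection e → e * p = e → IsStarProjection (star z * e * z) := by
    intro e he hep
    refine ⟨?_, ?_⟩
    · change star z * e * z * (star z * e * z) = _
      calc star z * e * z * (star z * e * z) = star z * (e * (z * star z) * e) * z := by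
            simp only [mul_assoc]
        _ = star z * e * z := by rw [hzz, hep, he.isIdempotentElem.eq]
    · simp only [IsSelfAdjoint, star_mul, star_star, he.isSelfAdjoint.star_eq, mul_assoc]
  have hrp' : r * p = r := (hr.le_iff_mul_eq_left hpp).1 hrp.le
  have hpr : p * r = r := (hr.le_iff_mul_eq_right hpp).1 hrp.le
  have hvp' : v * p = v := by
    rw [← sub_eq_zero, ← CStarRing.star_mul_self_eq_zero_iff]
    rw [star_sub, star_mul, hps, sub_mul, mul_sub, mul_sub, hvp, mul_assoc,
      ← mul_assoc (star v), hvp, hp2, mul_assoc, hvp, hp2]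
    simp
  have hpv : p * v = v := by
    rw [← sub_eq_zero, ← CStarRing.mul_star_self_eq_zero_iff]
    rw [star_sub, star_mul, hps, sub_mul, mul_sub, mul_sub, hvr, ← mul_assoc, mul_assoc p,
      hvr, hpr, ← mul_assoc, hvr, hrp']
    simp
  have hq : IsStarProjection (star z * z) := by
    have := hproj p hpp hp2
    rwa [hzp] at this
  have hq' := hproj r hr hrp'
  refine ⟨star z * z, hmem, hq, star z * v * z, star z * r * z, hq', ?_, ?_, ?_⟩
  · calc star (star z * v * z) * (star z * v * z) = star z * (star v * (z * star z * v)) * z := by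
          simp only [star_mul, star_star, mul_assoc]
      _ = star z * z := by rw [hzz, hpv, hvp, hzp]
  · calc star z * v * z * star (star z * v * z) = star z * (v * (z * star z) * star v) * z := by
          simp only [star_mul, star_star, mul_assoc]
      _ = star z * r * z := by rw [hzz, hvp', hvr]
  · refine lt_of_le_of_ne ?_ fun h => hrp.ne ?_
    · rw [hq'.le_iff_mul_eq_left hq]
      calc star z * r * z * (star z * z) = star z * (r * (z * star z)) * z := by
            simp only [mul_assoc]
        _ = _ := by rw [hzz, hrp']
    · calc r = (z * star z) * r * (z * star z) := by rw [hzz, hpr, hrp']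
        _ = z * (star z * r * z) * star z := by simp only [mul_assoc]
        _ = (z * star z) * (z * star z) := by rw [h]; simp only [mul_assoc]
        _ = p := by rw [hzz, hp2]

end Infinite

end CStarLemmas

open AlgGroupoid

/-! ### Representations of `C_c(G)` on `ℓ²(X)` from groupoid actions. -/

section

theorem two_mul_le_sq_add_sq (a b : ℝ≥0∞) : 2 * a * b ≤ a ^ 2 + b ^ 2 := by
  wlog h : a ≤ b generalizing a b
  · have := this b a (le_of_not_ge h)
    rwa [mul_right_comm, add_comm] at this
  obtain ⟨c, rfl⟩ := exists_add_of_le h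
  have : a ^ 2 + (a + c) ^ 2 = 2 * a * (a + c) + c ^ 2 := by ring
  rw [this]
  exact le_self_add

/-- The Cauchy-Schwarz inequality for sums with weights. -/
theorem tsum_mul_sq_le {ι : Type*} (a b : ι → ℝ≥0∞) :
    (∑' i, a i * b i) ^ 2 ≤ (∑' i, a i) * ∑' i, a i * b i ^ 2 := by
  have h2 : 2 * (∑' i, a i * b i) ^ 2 ≤ 2 * ((∑' i, a i) * ∑' i, a i * b i ^ 2) := by
    -- The doubled square is a double sum, to which `2 bᵢ bⱼ ≤ bᵢ² + bⱼ²` applies termwise with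
    -- weight `aᵢ aⱼ`. All sums live in `[0,∞]`, so no summability is needed.
    calc 2 * (∑' i, a i * b i) ^ 2 = ∑' i, ∑' j, 2 * ((a i * b i) * (a j * b j)) := by
          simp_rw [ENNReal.tsum_mul_left, ENNReal.tsum_mul_right, sq]
      _ ≤ ∑' i, ∑' j, (a j * (a i * b i ^ 2) + a i * (a j * b j ^ 2)) := by
          refine ENNReal.tsum_le_tsum fun i => ENNReal.tsum_le_tsum fun j => ?_
          calc 2 * ((a i * b i) * (a j * b j)) = a i * a j * (2 * b i * b j) := by ring
            _ ≤ a i * a j * (b i ^ 2 + b j ^ 2) := by gcongr; exact two_mul_le_sq_add_sq _ _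
            _ = _ := by ring
      _ = 2 * ((∑' i, a i) * ∑' i, a i * b i ^ 2) := by
          simp_rw [ENNReal.tsum_add, ENNReal.tsum_mul_left, ENNReal.tsum_mul_right,
            ENNReal.tsum_mul_left, two_mul]
  exact (ENNReal.mul_le_mul_iff_right (by simp) (by simp)).1 h2

/-- An action of a groupoid on a set. -/
structure GpdAction (G : Type u) [AlgGroupoid G] (X : Type u) where
  /-- the anchor map -/
  anchor : X → G
  /-- the action of `a` on `x`, meaningful when `src a = anchor x` -/
  act : G → X → X
  anchor_mem : ∀ x, anchor x ∈ unitSpace G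
  anchor_act : ∀ a x, src a = anchor x → anchor (act a x) = rng a
  act_act : ∀ a b x, src a = rng b → src b = anchor x → act a (act b x) = act (a * b) x
  act_anchor : ∀ x, act (anchor x) x = x

namespace GpdAction

section Algebra

variable {G : Type u} [AlgGroupoid G] {X : Type u} (α : GpdAction G X)

theorem act_inv_act (a : G) (x : X) (h : rng a = α.anchor x) : α.act a (α.act a⁻¹ x) = x := by
  rw [α.act_act _ _ _ (rng_inv a).symm ((src_inv a).trans h), mul_inv_self, h, α.act_anchor]

theorem anchor_act_inv (a : G) (x : X) (h : rng a = α.anchor x) :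
    α.anchor (α.act a⁻¹ x) = src a := by
  rw [α.anchor_act _ _ ((src_inv a).trans h), rng_inv]

/-- The involution `(x, a) ↦ (a⁻¹ x, a⁻¹)` of the set of pairs with `r(a)` the anchor of `x`. -/
def swapEquiv : (Σ x : X, {a : G // rng a = α.anchor x}) ≃
    (Σ x : X, {a : G // rng a = α.anchor x}) :=
  Function.Involutive.toPerm
    (fun z => ⟨α.act z.2.1⁻¹ z.1, z.2.1⁻¹, by rw [rng_inv, α.anchor_act_inv _ _ z.2.2]⟩) (by
    rintro ⟨x, a, ha⟩
    have h1 : α.act a⁻¹⁻¹ (α.act a⁻¹ x) = x := by rw [inv_inv', α.act_inv_act _ _ ha]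
    refine Sigma.ext h1 ?_
    refine (Subtype.heq_iff_coe_eq fun b => ?_).2 (inv_inv' a)
    simp only [h1])

/-- Reindexing by `swapEquiv` exchanges the two ends of an arrow, hence range sums and source sums
of `f`; this is where both halves of the `I`-norm enter. -/
theorem tsum_swap (F : X → G → ℝ≥0∞) :
    ∑' x, ∑' a : {a : G // rng a = α.anchor x}, F x a =
      ∑' x, ∑' a : {a : G // rng a = α.anchor x}, F (α.act a.1⁻¹ x) a.1⁻¹ := by
  rw [← ENNReal.tsum_sigma (fun x (a : {a : G // rng a = α.anchor x}) => F x a),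
    ← ENNReal.tsum_sigma
      (fun x (a : {a : G // rng a = α.anchor x}) => F (α.act a.1⁻¹ x) a.1⁻¹),
    ← α.swapEquiv.tsum_eq]
  rfl

end Algebra

variable {G : Type u} [TopologicalSpace G] [AlgGroupoid G] [EtaleGroupoid G] [T2Space G]
  {X : Type u} (α : GpdAction G X)

/-- The action of `f ∈ C_c(G)` on functions on `X`. -/
def conv (f : ConvAlg G) (ξ : X → ℂ) (x : X) : ℂ :=
  ∑' a : {a : G // rng a = α.anchor x}, f a * ξ (α.act a.1⁻¹ x)

theorem conv_eq (f : ConvAlg G) (ξ : X → ℂ) (x : X) {v : G} (hv : α.anchor x = v) :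
    α.conv f ξ x = ∑' a : {a : G // rng a = v}, f a * ξ (α.act a.1⁻¹ x) := by
  subst hv; rfl

theorem conv_add_left (f g : ConvAlg G) (ξ : X → ℂ) :
    α.conv (f + g) ξ = α.conv f ξ + α.conv g ξ := by
  funext x
  simp only [conv, Pi.add_apply, ConvAlg.add_apply, add_mul]
  exact (ConvAlg.summable_conv f _ fun a => ξ (α.act a⁻¹ x)).tsum_add
    (ConvAlg.summable_conv g _ fun a => ξ (α.act a⁻¹ x))

theorem conv_smul_left (c : ℂ) (f : ConvAlg G) (ξ : X → ℂ) :
    α.conv (c • f) ξ = c • α.conv f ξ := by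
  funext x
  simp only [conv, Pi.smul_apply, ConvAlg.smul_apply, mul_assoc, tsum_mul_left, smul_eq_mul]

theorem conv_add_right (f : ConvAlg G) (ξ η : X → ℂ) :
    α.conv f (ξ + η) = α.conv f ξ + α.conv f η := by
  funext x
  simp only [conv, Pi.add_apply, mul_add]
  exact (ConvAlg.summable_conv f _ fun a => ξ (α.act a⁻¹ x)).tsum_add
    (ConvAlg.summable_conv f _ fun a => η (α.act a⁻¹ x))

theorem conv_smul_right (c : ℂ) (f : ConvAlg G) (ξ : X → ℂ) :
    α.conv f (c • ξ) = c • α.conv f ξ := by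
  funext x
  simp only [conv, Pi.smul_apply, smul_eq_mul, mul_left_comm _ c, tsum_mul_left]

theorem conv_mul (f g : ConvAlg G) (ξ : X → ℂ) : α.conv (f * g) ξ = α.conv f (α.conv g ξ) := by
  funext x
  have hL : α.conv (f * g) ξ x = ∑' a : {a : G // rng a = α.anchor x},
      ∑' b : {b : G // rng b = α.anchor x}, f b * g (b.1⁻¹ * a) * ξ (α.act a.1⁻¹ x) := by
    refine tsum_congr fun a => ?_
    rw [ConvAlg.mul_apply' f g a.1 _ a.2, tsum_mul_right]
  have hR : α.conv f (α.conv g ξ) x = ∑' b : {b : G // rng b = α.anchor x},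
      ∑' a : {a : G // rng a = α.anchor x}, f b * g (b.1⁻¹ * a) * ξ (α.act a.1⁻¹ x) := by
    refine tsum_congr fun b => ?_
    rw [α.conv_eq g ξ _ (α.anchor_act_inv _ _ b.2), ← tsum_mul_left,
      ← (leftTranslate b.1 (α.anchor x) (src b.1) b.2 rfl).tsum_eq]
    refine tsum_congr fun d => ?_
    have hd : src b.1 = rng d.1 := d.2.symm
    simp only [leftTranslate, Equiv.coe_fn_mk]
    rw [inv_mul_cancel' _ _ hd, mul_inv_rev' _ _ hd,
      α.act_act _ _ _ ((src_inv _).trans (hd.symm.trans (rng_inv _).symm))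
        ((src_inv _).trans b.2), mul_assoc]
  rw [hL, hR]
  -- Only finitely many pairs contribute: `f b ≠ 0` leaves finitely many `b`, and for each of them
  -- `b⁻¹ a` must lie in the finite support of `g` on a fibre.
  refine Summable.tsum_comm (summable_of_hasFiniteSupport ?_)
  have hfin : (⋃ b ∈ {b : {b : G // rng b = α.anchor x} | f b ≠ 0},
      (fun a : {a : G // rng a = src b.1} =>
        leftTranslate b.1 (α.anchor x) (src b.1) b.2 rfl a) '' {a | g a ≠ 0}).Finite :=
    (ConvAlg.finite_support f (α.anchor x)).biUnion fun b _ =>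
      (ConvAlg.finite_support g (src b.1)).image _
  refine ((ConvAlg.finite_support f (α.anchor x)).prod hfin).subset ?_
  rintro ⟨b, a⟩ hab
  have hab' : f b * g (b.1⁻¹ * a) * ξ (α.act a.1⁻¹ x) ≠ 0 := hab
  have hb := left_ne_zero_of_mul (left_ne_zero_of_mul hab')
  have hg := right_ne_zero_of_mul (left_ne_zero_of_mul hab')
  refine ⟨hb, Set.mem_iUnion₂.2 ⟨b, hb, (leftTranslate b.1 (α.anchor x) (src b.1) b.2 rfl).symm a,
    hg, Equiv.apply_symm_apply _ _⟩⟩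

theorem tsum_fibre_mul_sq_le (f : ConvAlg G) (ξ : X → ℂ) :
    ∑' x, ∑' a : {a : G // rng a = α.anchor x}, ‖f a‖ₑ * ‖ξ (α.act a.1⁻¹ x)‖ₑ ^ 2 ≤
      f.iNorm * ∑' x, ‖ξ x‖ₑ ^ 2 := by
  rw [α.tsum_swap (fun x a => ‖f a‖ₑ * ‖ξ (α.act a⁻¹ x)‖ₑ ^ 2), ← ENNReal.tsum_mul_left]
  refine ENNReal.tsum_le_tsum fun x => ?_
  calc ∑' a : {a : G // rng a = α.anchor x},
        ‖f a.1⁻¹‖ₑ * ‖ξ (α.act a.1⁻¹⁻¹ (α.act a.1⁻¹ x))‖ₑ ^ 2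
      = ∑' a : {a : G // rng a = α.anchor x}, ‖(star f) a‖ₑ * ‖ξ x‖ₑ ^ 2 := by
        refine tsum_congr fun a => ?_
        rw [inv_inv', α.act_inv_act _ _ a.2, ConvAlg.star_apply]
        simp [enorm_eq_nnnorm]
    _ ≤ f.iNorm * ‖ξ x‖ₑ ^ 2 := by
        rw [ENNReal.tsum_mul_right, ← ConvAlg.iNorm_star f]
        gcongr
        exact ConvAlg.tsum_rng_le_iNorm _ (α.anchor_mem x)

/-- This is Schur's test: Cauchy-Schwarz with weight `|f|` uses the range sums, and
`tsum_fibre_mul_sq_le` uses the source sums. -/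
theorem tsum_conv_sq_le (f : ConvAlg G) (ξ : X → ℂ) :
    ∑' x, ‖α.conv f ξ x‖ₑ ^ 2 ≤ f.iNorm ^ 2 * ∑' x, ‖ξ x‖ₑ ^ 2 := by
  calc ∑' x, ‖α.conv f ξ x‖ₑ ^ 2
      ≤ ∑' x, f.iNorm *
          ∑' a : {a : G // rng a = α.anchor x}, ‖f a‖ₑ * ‖ξ (α.act a.1⁻¹ x)‖ₑ ^ 2 := by
        refine ENNReal.tsum_le_tsum fun x => ?_
        have h1 : ‖α.conv f ξ x‖ₑ ≤
            ∑' a : {a : G // rng a = α.anchor x}, ‖f a‖ₑ * ‖ξ (α.act a.1⁻¹ x)‖ₑ :=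
          enorm_tsum_le_tsum_enorm.trans (le_of_eq (tsum_congr fun a => enorm_mul _ _))
        refine (pow_le_pow_left₀ zero_le h1 2).trans ((tsum_mul_sq_le _ _).trans ?_)
        gcongr
        exact ConvAlg.tsum_rng_le_iNorm _ (α.anchor_mem x)
    _ ≤ _ := by
        rw [ENNReal.tsum_mul_left, sq, mul_assoc]
        gcongr
        exact α.tsum_fibre_mul_sq_le f ξ

end GpdAction

section L2

variable {X : Type u}

theorem memℓp_two_iff (ξ : X → ℂ) : Memℓp ξ 2 ↔ ∑' x, ‖ξ x‖ₑ ^ 2 ≠ ∞ := by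
  rw [memℓp_gen_iff (by simp)]
  have h : ∀ x, ‖ξ x‖ₑ ^ 2 = ENNReal.ofReal (‖ξ x‖ ^ (2 : ℝ≥0∞).toReal) := fun x => by
    simp [← ofReal_norm, ENNReal.ofReal_pow]
  simp_rw [h]
  constructor
  · intro hs
    rw [← ENNReal.ofReal_tsum_of_nonneg (fun x => by positivity) hs]
    exact ENNReal.ofReal_ne_top
  · intro hs
    refine (ENNReal.summable_toReal hs).congr fun x => ?_
    rw [ENNReal.toReal_ofReal (by positivity)]

theorem tsum_enorm_sq (ξ : lp (fun _ : X => ℂ) 2) : ∑' x, ‖ξ x‖ₑ ^ 2 = ‖ξ‖ₑ ^ 2 := by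
  have h : ∀ x, ‖ξ x‖ₑ ^ 2 = ENNReal.ofReal (‖ξ x‖ ^ (2 : ℝ≥0∞).toReal) := fun x => by
    simp [← ofReal_norm, ENNReal.ofReal_pow]
  simp_rw [h]
  rw [← ENNReal.ofReal_tsum_of_nonneg (fun x => by positivity) ((lp.memℓp ξ).summable (by simp)),
    ← lp.norm_rpow_eq_tsum (by simp)]
  simp [← ofReal_norm, ENNReal.ofReal_pow]

end L2

namespace GpdAction

variable {G : Type u} [TopologicalSpace G] [AlgGroupoid G] [EtaleGroupoid G] [T2Space G]
  {X : Type u} (α : GpdAction G X)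

theorem memℓp_conv (f : ConvAlg G) (ξ : lp (fun _ : X => ℂ) 2) : Memℓp (α.conv f ξ) 2 := by
  rw [memℓp_two_iff]
  refine ne_top_of_le_ne_top ?_ (α.tsum_conv_sq_le f ξ)
  exact ENNReal.mul_ne_top (ENNReal.pow_ne_top f.iNorm_ne_top) ((memℓp_two_iff _).1 (lp.memℓp ξ))

/-- The operator of `f ∈ C_c(G)` on `ℓ²(X)`. -/
def op (f : ConvAlg G) : lp (fun _ : X => ℂ) 2 →L[ℂ] lp (fun _ : X => ℂ) 2 :=
  LinearMap.mkContinuous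
    { toFun ξ := ⟨α.conv f ξ, α.memℓp_conv f ξ⟩
      map_add' ξ η := Subtype.ext (α.conv_add_right f ξ η)
      map_smul' c ξ := Subtype.ext (α.conv_smul_right c f ξ) } f.iNorm.toReal (fun ξ => by
    set η : lp (fun _ : X => ℂ) 2 := ⟨α.conv f ξ, α.memℓp_conv f ξ⟩
    have h : ‖η‖ₑ ^ 2 ≤ (f.iNorm * ‖ξ‖ₑ) ^ 2 := by
      rw [← tsum_enorm_sq, mul_pow, ← tsum_enorm_sq]
      exact α.tsum_conv_sq_le f ξ
    have h' := ENNReal.toReal_mono (ENNReal.mul_ne_top f.iNorm_ne_top enorm_ne_top)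
      ((ENNReal.pow_le_pow_left_iff two_ne_zero).1 h)
    rw [ENNReal.toReal_mul, toReal_enorm, toReal_enorm] at h'
    exact h')

theorem op_apply (f : ConvAlg G) (ξ : lp (fun _ : X => ℂ) 2) (x : X) :
    α.op f ξ x = α.conv f ξ x := rfl

theorem norm_op_le (f : ConvAlg G) : ‖α.op f‖ ≤ f.iNorm.toReal :=
  LinearMap.mkContinuous_norm_le _ ENNReal.toReal_nonneg _

theorem inner_op (f : ConvAlg G) (ξ η : lp (fun _ : X => ℂ) 2) :
    inner ℂ (α.op f ξ) η = inner ℂ ξ (α.op (star f) η) := by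
  -- Both inner products are sums of `F` over pairs (point, arrow), in two orders related by
  -- `swapEquiv`. Absolute convergence follows from `|ξ η| ≤ |ξ|² + |η|²`.
  set F : (Σ x : X, {a : G // rng a = α.anchor x}) → ℂ := fun z =>
    star (f z.2.1) * star (ξ (α.act z.2.1⁻¹ z.1)) * η z.1 with hF
  have hFs : Summable F := by
    refine Summable.of_enorm ?_
    rw [ENNReal.tsum_sigma']
    have hle : ∀ x, ∑' a : {a : G // rng a = α.anchor x}, ‖F ⟨x, a⟩‖ₑ ≤
        (∑' a : {a : G // rng a = α.anchor x}, ‖f a‖ₑ * ‖ξ (α.act a.1⁻¹ x)‖ₑ ^ 2) +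
          f.iNorm * ‖η x‖ₑ ^ 2 := by
      intro x
      calc ∑' a : {a : G // rng a = α.anchor x}, ‖F ⟨x, a⟩‖ₑ
          ≤ ∑' a : {a : G // rng a = α.anchor x},
              (‖f a‖ₑ * ‖ξ (α.act a.1⁻¹ x)‖ₑ ^ 2 + ‖f a‖ₑ * ‖η x‖ₑ ^ 2) := by
            refine ENNReal.tsum_le_tsum fun a => ?_
            have h1 : ‖F ⟨x, a⟩‖ₑ = ‖f a‖ₑ * (‖ξ (α.act a.1⁻¹ x)‖ₑ * ‖η x‖ₑ) := by
              simp [hF, mul_assoc, enorm_eq_nnnorm]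
            rw [h1, ← mul_add]
            gcongr
            refine le_trans ?_ (two_mul_le_sq_add_sq _ _)
            rw [mul_assoc, two_mul]
            exact le_self_add
        _ ≤ _ := by
            rw [ENNReal.tsum_add, ENNReal.tsum_mul_right]
            gcongr
            exact ConvAlg.tsum_rng_le_iNorm _ (α.anchor_mem x)
    refine ne_top_of_le_ne_top ?_ (ENNReal.tsum_le_tsum hle)
    rw [ENNReal.tsum_add, ENNReal.tsum_mul_left]
    refine ENNReal.add_ne_top.2 ⟨ne_top_of_le_ne_top ?_ (α.tsum_fibre_mul_sq_le f ξ), ?_⟩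
    · exact ENNReal.mul_ne_top f.iNorm_ne_top ((memℓp_two_iff _).1 (lp.memℓp ξ))
    · exact ENNReal.mul_ne_top f.iNorm_ne_top ((memℓp_two_iff _).1 (lp.memℓp η))
  rw [lp.inner_eq_tsum, lp.inner_eq_tsum]
  have h1 : ∀ x, inner ℂ (α.op f ξ x) (η x) =
      ∑' a : {a : G // rng a = α.anchor x}, F ⟨x, a⟩ := by
    intro x
    rw [RCLike.inner_apply, op_apply, conv, mul_comm, starRingEnd_apply, tsum_star,
      ← tsum_mul_right]
    exact tsum_congr fun a => by rw [star_mul, hF, mul_comm (star _) (star _)]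
  have h2 : ∀ x, inner ℂ (ξ x) (α.op (star f) η x) =
      ∑' a : {a : G // rng a = α.anchor x}, F (α.swapEquiv ⟨x, a⟩) := by
    intro x
    rw [RCLike.inner_apply, op_apply, conv, mul_comm, starRingEnd_apply, ← tsum_mul_left]
    refine tsum_congr fun a => ?_
    change _ = star (f a.1⁻¹) * star (ξ (α.act a.1⁻¹⁻¹ (α.act a.1⁻¹ x))) * η (α.act a.1⁻¹ x)
    rw [inv_inv', α.act_inv_act _ _ a.2, ConvAlg.star_apply]
    ring
  rw [tsum_congr h1, tsum_congr h2, ← hFs.tsum_sigma, ← α.swapEquiv.tsum_eq F,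
    ← (α.swapEquiv.summable_iff.2 hFs).tsum_sigma (f := fun z => F (α.swapEquiv z))]

/-- The `*`-representation of `C_c(G)` on `ℓ²(X)` given by an action of `G` on `X`. -/
def rep : BoundedRep G where
  H := lp (fun _ : X => ℂ) 2
  π :=
    { toFun := α.op
      map_smul' c f := by ext1 ξ; exact lp.ext (α.conv_smul_left c f ξ)
      map_zero' := by
        ext1 ξ
        refine lp.ext ?_
        have := α.conv_smul_left 0 0 ξ
        rw [zero_smul, zero_smul] at this
        exact this
      map_add' f g := by ext1 ξ; exact lp.ext (α.conv_add_left f g ξ)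
      map_mul' f g := by ext1 ξ; exact lp.ext (α.conv_mul f g ξ)
      map_star' f := by
        rw [ContinuousLinearMap.star_eq_adjoint, ContinuousLinearMap.eq_adjoint_iff]
        intro ξ η
        rw [inner_op, star_star] }
  bounded := ⟨1, fun f => by
    rw [ENNReal.coe_one, one_mul, ← ofReal_norm]
    exact ENNReal.ofReal_le_of_le_toReal (α.norm_op_le f)⟩

end GpdAction

end

/-! ### The regular and unit-space representations, and consequences of simplicity. -/

section

section Algebra

variable {G : Type u} [AlgGroupoid G]

variable (G) in
/-- The action of a groupoid on itself by left multiplication. -/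
def regAction : GpdAction G G where
  anchor := rng
  act a x := a * x
  anchor_mem := rng_mem_unitSpace
  anchor_act a x h := rng_mul a x h
  act_act a b x h h' := (mul_assoc' a b x h h').symm
  act_anchor := rng_mul_self

variable (G) in
/-- The action of a groupoid on its unit space. -/
def unitAction : GpdAction G (unitSpace G) where
  anchor x := x
  act a _ := rngU a
  anchor_mem x := x.2
  anchor_act _ _ _ := rfl
  act_act a b _ h _ := Subtype.ext (rng_mul a b h).symm
  act_anchor x := Subtype.ext (rng_of_mem_unitSpace x.2)

theorem inv_of_mem_unitSpace {a : G} (ha : a ∈ unitSpace G) : a⁻¹ = a := by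
  have h1 := rng_mul_self a⁻¹
  rwa [rng_inv, src_of_mem_unitSpace ha, mul_inv_self, rng_of_mem_unitSpace ha, eq_comm] at h1

end Algebra

variable {G : Type u} [TopologicalSpace G] [AlgGroupoid G] [EtaleGroupoid G] [T2Space G]

/-- A function supported in the unit space acts by pointwise multiplication. -/
theorem GpdAction.conv_of_support_subset {X : Type u} (α : GpdAction G X) {k : ConvAlg G}
    (hk : ∀ c, k c ≠ 0 → c ∈ unitSpace G) (ξ : X → ℂ) (x : X) :
    α.conv k ξ x = k (α.anchor x) * ξ x := by
  have hx := α.anchor_mem x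
  rw [conv, tsum_eq_single ⟨α.anchor x, rng_of_mem_unitSpace hx⟩]
  · simp only [inv_of_mem_unitSpace hx, α.act_anchor]
  · intro a ha
    by_contra hne
    have h1 := hk _ (left_ne_zero_of_mul hne)
    exact ha (Subtype.ext ((rng_of_mem_unitSpace h1).symm.trans a.2))

/-- The only arrow carrying `y` to `x` is `x * y⁻¹`; thus the values of `f` are the matrix
coefficients of the regular representation. -/
theorem regAction_conv_single [DecidableEq G] (f : ConvAlg G) {x y : G} (h : src x = src y) :
    (regAction G).conv f (lp.single (E := fun _ : G => ℂ) 2 y 1) x = f (x * y⁻¹) := by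
  have hc : src x = rng y⁻¹ := by rw [rng_inv, h]
  rw [GpdAction.conv, tsum_eq_single ⟨x * y⁻¹, rng_mul _ _ hc⟩]
  · have h1 : (x * y⁻¹)⁻¹ * x = y := by
      rw [mul_inv_rev' _ _ hc, inv_inv', mul_assoc' _ _ _ (by rw [rng_inv, h]) (src_inv x),
        inv_mul_self, h, mul_src]
    simp only [regAction, h1, lp.single_apply_self, mul_one]
  · rintro ⟨a, ha⟩ hne
    have ha' : rng a = rng x := ha
    have h2 : a⁻¹ * x ≠ y := by
      rintro rfl
      refine hne (Subtype.ext ?_)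
      change a = x * (a⁻¹ * x)⁻¹
      rw [mul_inv_rev' _ _ ((src_inv a).trans ha'), inv_inv',
        ← mul_assoc' _ _ _ (rng_inv x).symm (by rw [src_inv, ha']), mul_inv_self, ← ha',
        rng_mul_self]
    simp only [regAction]
    rw [lp.single_apply_ne _ _ _ h2, mul_zero]

/-- The extension of a bounded representation to `C⋆(G)`. -/
def BoundedRep.ext (ρ : BoundedRep G) : FullCStar G →⋆ₙₐ[ℂ] (ρ.H →L[ℂ] ρ.H) where
  toFun a := (a.1 : lp (fun ρ : BoundedRep G => ρ.H →L[ℂ] ρ.H) ∞) ρ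
  map_smul' _ _ := rfl
  map_zero' := rfl
  map_add' _ _ := rfl
  map_mul' _ _ := rfl
  map_star' _ := rfl

theorem BoundedRep.ext_toFullCStar (ρ : BoundedRep G) (f : ConvAlg G) :
    ρ.ext (toFullCStar f) = ρ.π f := rfl

theorem BoundedRep.norm_ext_le (ρ : BoundedRep G) (a : FullCStar G) : ‖ρ.ext a‖ ≤ ‖a‖ :=
  lp.norm_apply_le_norm ENNReal.top_ne_zero _ ρ

theorem BoundedRep.continuous_ext (ρ : BoundedRep G) : Continuous ρ.ext :=
  AddMonoidHomClass.continuous_of_bound ρ.ext 1 fun a => by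
    rw [one_mul]; exact ρ.norm_ext_le a

/-- A nonzero representation of a simple full C⋆-algebra is faithful. -/
theorem BoundedRep.ext_injective (hA : IsSimpleCStar (FullCStar G)) (ρ : BoundedRep G)
    {f : ConvAlg G} (hf : ρ.π f ≠ 0) {a : FullCStar G} (ha : ρ.ext a = 0) : a = 0 := by
  have hmem : ∀ x, x ∈ TwoSidedIdeal.ker ρ.ext ↔ ρ.ext x = 0 := fun x => TwoSidedIdeal.mem_ker _
  have hcl : IsClosed (TwoSidedIdeal.ker ρ.ext : Set (FullCStar G)) := by
    have : (TwoSidedIdeal.ker ρ.ext : Set (FullCStar G)) = ρ.ext ⁻¹' {0} := by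
      ext x; exact hmem x
    rw [this]
    exact isClosed_singleton.preimage ρ.continuous_ext
  rcases hA.2 _ hcl with h | h
  · have h1 := (hmem a).2 ha
    rw [h] at h1
    simpa using h1
  · exact absurd ((hmem (toFullCStar f)).1 (by rw [h]; trivial)) hf

theorem regAction_op_apply_single [DecidableEq G] (f : ConvAlg G) {x y : G} (h : src x = src y) :
    (regAction G).op f (lp.single (E := fun _ : G => ℂ) 2 y 1) x = f (x * y⁻¹) :=
  regAction_conv_single f h

/-- The value `f c` is the matrix coefficient between the point masses at `src c` and at `c`. -/
theorem regAction_rep_ne_zero {f : ConvAlg G} (hf : f ≠ 0) : (regAction G).rep.π f ≠ 0 := by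
  classical
  intro h
  refine hf (ConvAlg.ext fun c => ?_)
  replace h : (regAction G).op f = 0 := h
  have h1 := regAction_op_apply_single f (src_src c).symm
  rw [h, inv_of_mem_unitSpace (src_mem_unitSpace c), mul_src] at h1
  exact h1.symm

theorem toFullCStar_ne_zero {f : ConvAlg G} (hf : f ≠ 0) : toFullCStar f ≠ 0 := fun h =>
  regAction_rep_ne_zero hf (by rw [← BoundedRep.ext_toFullCStar, h, map_zero])

theorem exists_convAlg_ne_zero (hA : IsSimpleCStar (FullCStar G)) : ∃ f : ConvAlg G, f ≠ 0 := by
  by_contra! h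
  obtain ⟨a, ha⟩ := @exists_ne _ hA.1 (0 : FullCStar G)
  obtain ⟨f, hf⟩ := (denseRange_toFullCStar (G := G)).exists_dist_lt a (norm_pos_iff.2 ha)
  rw [h f, map_zero, dist_zero_right] at hf
  exact lt_irrefl _ hf

/-- In a simple full C⋆-algebra, a nonzero element `b⋆b` has a nonzero value at a unit. -/
theorem exists_unit_pos (hA : IsSimpleCStar (FullCStar G)) {b : FullCStar G} (hb : b ≠ 0) :
    ∃ v ∈ unitSpace G, ∃ η : ℝ, 0 < η ∧
      ∀ f : ConvAlg G, ‖f v - η‖ ≤ ‖toFullCStar f - star b * b‖ := by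
  classical
  obtain ⟨f, hf⟩ := exists_convAlg_ne_zero hA
  set ρ : BoundedRep G := (regAction G).rep with hρ
  have h1 : ρ.ext b ≠ 0 := fun h => hb (ρ.ext_injective hA (regAction_rep_ne_zero hf) h)
  -- Point masses span a dense subspace of `ℓ²(G)`, so a nonzero operator moves one of them.
  obtain ⟨γ, hγ⟩ : ∃ γ : G, ρ.ext b (lp.single (E := fun _ : G => ℂ) 2 γ 1) ≠ 0 := by
    by_contra! h
    apply h1
    refine lp.ext_continuousLinearMap (E := fun _ : G => ℂ) (p := 2) ENNReal.ofNat_ne_top ?_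
    intro γ
    ext1
    exact h γ
  set δ : ρ.H := lp.single (E := fun _ : G => ℂ) 2 γ 1 with hδ
  have hδ1 : ‖δ‖ = 1 := by
    refine (lp.norm_single (E := fun _ : G => ℂ) (p := 2) (by simp) γ 1).trans ?_
    simp
  refine ⟨rng γ, rng_mem_unitSpace γ, ‖ρ.ext b δ‖ ^ 2, by positivity, fun f => ?_⟩
  -- The diagonal coefficient at `δ_γ` is `f (γ * γ⁻¹)`, the value of `f` at the unit `rng γ`.
  have h2 : inner ℂ δ (ρ.ext (toFullCStar f) δ) = f (rng γ) := by
    rw [← mul_inv_self, ← regAction_op_apply_single f (rfl : src γ = src γ)]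
    refine (lp.inner_single_left (𝕜 := ℂ) (G := fun _ : G => ℂ) γ 1 _).trans ?_
    simp [RCLike.inner_apply]
    rfl
  have h3 : inner ℂ δ (ρ.ext (star b * b) δ) = ((‖ρ.ext b δ‖ ^ 2 : ℝ) : ℂ) := by
    rw [map_mul, map_star, ContinuousLinearMap.star_eq_adjoint, mul_apply_eq_comp,
      ContinuousLinearMap.adjoint_inner_right, inner_self_eq_norm_sq_to_K]
    simp
  rw [← h2, ← h3, ← inner_sub_right, ← sub_apply, ← map_sub]
  refine (norm_inner_le_norm _ _).trans ?_
  rw [hδ1, one_mul]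
  refine (ContinuousLinearMap.le_opNorm _ _).trans ?_
  rw [hδ1, mul_one]
  exact ρ.norm_ext_le _

/-! ### Functions on bisections, and triviality of the interior of the isotropy. -/

section Lift

/-- An injective restriction of the local homeomorphism `src` to an open set is an open embedding,
so it pulls compact subsets of its image back to compact sets. -/
theorem isCompact_inter_preimage_src {B K : Set G} (hB : IsOpen B) (hinj : Set.InjOn src B)
    (hK : IsCompact K) (hKB : K ⊆ src '' B) : IsCompact (B ∩ src ⁻¹' K) := by
  have he : Topology.IsOpenEmbedding fun b : B => src (b : G) :=
    .of_continuous_injective_isOpenMap (continuous_src.comp continuous_subtype_val)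
      hinj.injective (isLocalHomeomorph_src.isOpenMap.comp hB.isOpenMap_subtype_val)
  have h1 := he.isInducing.isCompact_preimage' hK (by
    rintro _ hx
    obtain ⟨b, hb, rfl⟩ := hKB hx
    exact ⟨⟨b, hb⟩, rfl⟩)
  have h2 := h1.image continuous_subtype_val
  convert h2 using 1
  ext c
  simp [and_comm]

open Classical in
/-- The function on an open set `B` with injective source map given by a function on `s(B)`. -/
theorem exists_lift {B : Set G} (hB : IsOpen B) (hinj : Set.InjOn src B) {h : G → ℂ}
    (hc : Continuous h) (hs : HasCompactSupport h) (hsub : tsupport h ⊆ src '' B) :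
    ∃ f : ConvAlg G, ∀ c, f c = if c ∈ B then h (src c) else 0 := by
  have hC := isCompact_inter_preimage_src hB hinj hs hsub
  refine ⟨ConvAlg.mk (fun c => if c ∈ B then h (src c) else 0) ?_ ?_, fun c => rfl⟩
  · rw [continuous_iff_continuousAt]
    intro c
    by_cases hcB : c ∈ B
    · refine (hc.comp continuous_src).continuousAt.congr ?_
      filter_upwards [hB.mem_nhds hcB] with d hd
      simp [hd]
    -- The lift vanishes off the compact, hence closed, set `B ∩ src⁻¹(tsupport h)`, so extension by
    -- zero is continuous outside `B`.
    · refine (continuousAt_const (y := (0 : ℂ))).congr ?_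
      filter_upwards [hC.isClosed.isOpen_compl.mem_nhds fun h => hcB h.1] with d hd
      split_ifs with hdB
      · by_contra hne
        exact hd ⟨hdB, subset_tsupport _ (Ne.symm hne)⟩
      · rfl
  · refine HasCompactSupport.intro hC fun c hcC => ?_
    split_ifs with hcB
    · by_contra hne
      exact hcC ⟨hcB, subset_tsupport _ hne⟩
    · rfl

variable [LocallyCompactSpace G]

/-- Bump functions. -/
theorem exists_bump {K U : Set G} (hK : IsCompact K) (hU : IsOpen U) (hKU : K ⊆ U) :
    ∃ h : G → ℝ, Continuous h ∧ HasCompactSupport h ∧ tsupport h ⊆ U ∧ (∀ c ∈ K, h c = 1) ∧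
      ∀ c, 0 ≤ h c ∧ h c ≤ 1 := by
  obtain ⟨k, hk1, hk2, hk3⟩ := exists_compact_closed_between hK hU hKU
  obtain ⟨f, hf1, hf0, hfc, hf⟩ := exists_continuous_one_zero_of_isCompact hK
    isOpen_interior.isClosed_compl (Set.disjoint_compl_right_iff_subset.2 hk3.1)
  refine ⟨f, f.continuous, hfc, ?_, fun c hc => hf1 hc, hf⟩
  refine (closure_minimal (fun c hc => ?_) hk2).trans hk3.2
  by_contra hck
  exact hc (hf0 fun h => hck (interior_subset h))

/-- If `C⋆(G)` is simple, then the interior of the isotropy consists of units. -/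
theorem exists_src_ne_rng (hA : IsSimpleCStar (FullCStar G)) {O : Set G} (hO : IsOpen O)
    (hne : O.Nonempty) (hOu : Disjoint O (unitSpace G)) : ∃ c ∈ O, src c ≠ rng c := by
  classical
  by_contra! hiso
  obtain ⟨γ, hγ⟩ := hne
  obtain ⟨e, hγe, he⟩ := isLocalHomeomorph_src (G := G) γ
  set B := O ∩ e.source with hBdef
  have hB : IsOpen B := hO.inter e.open_source
  have hinj : Set.InjOn src B := by
    rw [he]; exact e.injOn.mono Set.inter_subset_right
  have hγB : γ ∈ B := ⟨hγ, hγe⟩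
  obtain ⟨h, hc, hs, hsub, h1, -⟩ := exists_bump (isCompact_singleton (x := src γ))
    (isLocalHomeomorph_src.isOpenMap _ hB) (by simpa using ⟨γ, hγB, rfl⟩)
  have hs' : tsupport (fun c => (h c : ℂ)) ⊆ tsupport h :=
    closure_mono fun c hc => by simpa using hc
  have hcc : HasCompactSupport fun c => (h c : ℂ) := hs.of_isClosed_subset (isClosed_tsupport _) hs'
  obtain ⟨f, hf⟩ := exists_lift hB hinj (Complex.continuous_ofReal.comp hc) hcc (hs'.trans hsub)
  set g : ConvAlg G := ConvAlg.mk (fun c => (h c : ℂ)) (Complex.continuous_ofReal.comp hc) hcc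
  have hzero : ∀ c, c ∉ src '' B → h c = 0 := fun c hcB => by
    by_contra hne
    exact hcB (hsub (subset_tsupport _ hne))
  have hg : ∀ c, g c ≠ 0 → c ∈ unitSpace G := by
    intro c hc
    by_contra hcu
    refine hc ?_
    change (h c : ℂ) = 0
    rw [hzero c, Complex.ofReal_zero]
    rintro ⟨b, -, rfl⟩
    exact hcu (src_mem_unitSpace b)
  set ρ := (unitAction G).rep
  -- `f` places the values of `h` on the arrows of `B` and `g` places them on their sources. By
  -- `hiso` each such arrow fixes its unit, so `f` and `g` act alike on `ℓ²(G⁽⁰⁾)`.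
  have hconv : ∀ ξ : unitSpace G → ℂ, (unitAction G).conv f ξ = (unitAction G).conv g ξ := by
    intro ξ
    funext x
    rw [(unitAction G).conv_of_support_subset hg]
    change ∑' a : {a : G // rng a = (x : G)}, f a * ξ (rngU a.1⁻¹) = h x * ξ x
    have hval : ∀ a : {a : G // rng a = (x : G)}, f a * ξ (rngU a.1⁻¹) ≠ 0 →
        a.1 ∈ B ∧ src a.1 = x := by
      intro a ha
      have haB : a.1 ∈ B := by
        by_contra haB
        exact left_ne_zero_of_mul ha (by rw [hf, if_neg haB])
      exact ⟨haB, (hiso _ haB.1).trans a.2⟩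
    by_cases hx : (x : G) ∈ src '' B
    · obtain ⟨b, hb, hbx⟩ := hx
      have hb' : rng b = (x : G) := (hiso b hb.1).symm.trans hbx
      rw [tsum_eq_single ⟨b, hb'⟩]
      · have : rngU b⁻¹ = x := Subtype.ext ((rng_inv b).trans hbx)
        simp only [this, hf, if_pos hb, hbx]
        rfl
      · intro a ha
        by_contra hne
        exact ha (Subtype.ext (hinj (hval a hne).1 hb ((hval a hne).2.trans hbx.symm)))
    · rw [hzero _ hx, Complex.ofReal_zero, zero_mul]
      refine (tsum_congr fun a => ?_).trans tsum_zero
      by_contra hne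
      exact hx ⟨a, hval a hne⟩
  have hfg : ρ.π f = ρ.π g := by
    ext1 ξ
    exact lp.ext (hconv _)
  have hρg : ρ.π g ≠ 0 := by
    intro h0
    have h2 := (unitAction G).conv_of_support_subset hg
      (lp.single (E := fun _ : unitSpace G => ℂ) 2 (srcU γ) 1) (srcU γ)
    rw [lp.single_apply_self] at h2
    replace h0 : (unitAction G).op g = 0 := h0
    have h3 : (unitAction G).op g (lp.single (E := fun _ : unitSpace G => ℂ) 2 (srcU γ) 1)
      (srcU γ) = g (src γ) * 1 := h2
    rw [h0] at h3
    have h4 : (0 : ℂ) = (h (src γ) : ℂ) * 1 := h3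
    rw [h1 _ rfl] at h4
    simp at h4
  -- Faithfulness forces `f = g`, although `f γ = 1` and `g γ = 0` because `γ` is not a unit.
  have h5 : toFullCStar (f - g) = 0 := by
    refine ρ.ext_injective hA hρg ?_
    rw [ρ.ext_toFullCStar, map_sub, hfg, sub_self]
  have h6 : f = g := by
    by_contra hne
    exact toFullCStar_ne_zero (sub_ne_zero.2 hne) h5
  have h7 : f γ = g γ := by rw [h6]
  have h8 : g γ = 0 := by
    by_contra hne
    exact Set.disjoint_left.1 hOu hγ (hg _ hne)
  rw [h8, hf, if_pos hγB] at h7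
  simp [h1 _ rfl] at h7

end Lift

end

/-! ### Functions on the unit space, contracting bisections and effectiveness. -/

section

variable {G : Type u} [TopologicalSpace G] [AlgGroupoid G] [EtaleGroupoid G] [T2Space G]

section Diagonal

variable {k : ConvAlg G} (hk : ∀ c, k c ≠ 0 → c ∈ unitSpace G)
include hk

theorem star_apply_of_support_subset (c : G) : (star k) c = star (k c) := by
  rw [ConvAlg.star_apply]
  by_cases hc : c ∈ unitSpace G
  · rw [inv_of_mem_unitSpace hc]
  · have h1 : k c = 0 := by
      by_contra h
      exact hc (hk _ h)
    have h2 : k c⁻¹ = 0 := by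
      by_contra h
      refine hc ?_
      have := hk _ h
      rw [← inv_inv' c, inv_of_mem_unitSpace this]
      exact this
    rw [h1, h2]

theorem mul_apply_of_left_support_subset (f : ConvAlg G) (c : G) :
    (k * f) c = k (rng c) * f c :=
  (regAction G).conv_of_support_subset hk f c

theorem mul_apply_of_right_support_subset (f : ConvAlg G) (c : G) :
    (f * k) c = f c * k (src c) := by
  have hk' : ∀ c, (star k) c ≠ 0 → c ∈ unitSpace G := fun c hc => hk c (by
    rw [star_apply_of_support_subset hk] at hc
    exact star_ne_zero.1 hc)
  have h1 : f * k = star (star k * star f) := by rw [star_mul, star_star, star_star]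
  rw [h1, ConvAlg.star_apply, mul_apply_of_left_support_subset hk',
    star_apply_of_support_subset hk, ConvAlg.star_apply, inv_inv', rng_inv, star_mul, star_star,
    star_star]

/-- Each fibre of `src` or `rng` contains exactly one unit, so every sum in the `I`-norm has at most
one nonzero term. -/
theorem iNorm_le_of_support_subset {M : ℝ≥0∞} (hM : ∀ c, ‖k c‖ₑ ≤ M) : k.iNorm ≤ M := by
  refine iSup_le fun v => max_le ?_ ?_
  · rw [tsum_eq_single ⟨v, src_of_mem_unitSpace v.2⟩]
    · exact hM _
    · intro c hc
      rw [enorm_eq_zero]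
      by_contra hne
      exact hc (Subtype.ext ((src_of_mem_unitSpace (hk _ hne)).symm.trans c.2))
  · rw [tsum_eq_single ⟨v, rng_of_mem_unitSpace v.2⟩]
    · exact hM _
    · intro c hc
      rw [enorm_eq_zero]
      by_contra hne
      exact hc (Subtype.ext ((rng_of_mem_unitSpace (hk _ hne)).symm.trans c.2))

end Diagonal

theorem norm_toFullCStar_le (f : ConvAlg G) : ‖toFullCStar f‖ ≤ f.iNorm.toReal := by
  rw [norm_toFullCStar]
  exact Real.iSup_le (fun ρ => ρ.norm_le f) ENNReal.toReal_nonneg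

/-- If `x` is supported on a bisection `B`, then `x⋆x` is a function on the unit space. -/
theorem star_mul_self_apply_of_bisection {B : Set G} (hsrc : Set.InjOn src B)
    (hrng : Set.InjOn rng B) {h : G → ℂ} (hh : ∀ c, h c ≠ 0 → c ∈ src '' B) {x : ConvAlg G}
    (hxB : ∀ c ∉ B, x c = 0) (hx : ∀ c ∈ B, x c = h (src c)) (c : G) :
    (star x * x) c = star (h c) * h c := by
  rw [ConvAlg.mul_apply]
  by_cases hc : c ∈ src '' B
  · obtain ⟨b, hb, rfl⟩ := hc
    rw [tsum_eq_single ⟨b⁻¹, by rw [rng_inv, rng_src]⟩]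
    · simp only [ConvAlg.star_apply, inv_inv', mul_src, hx b hb]
    · intro a ha
      have hsa : src a.1⁻¹ = src b := by rw [src_inv, a.2, rng_src]
      by_cases haB : a.1⁻¹ ∈ B
      · refine absurd (Subtype.ext ?_) ha
        exact (inv_inv' a.1).symm.trans (congrArg Inv.inv (hsrc haB hb hsa))
      · rw [ConvAlg.star_apply, hxB _ haB, star_zero, zero_mul]
  · have h0 : h c = 0 := by
      by_contra hne
      exact hc (hh _ hne)
    rw [h0, mul_zero]
    refine (tsum_congr fun a => ?_).trans tsum_zero
    by_contra hne
    have h1 : a.1⁻¹ ∈ B := by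
      by_contra haB
      exact left_ne_zero_of_mul hne (by rw [ConvAlg.star_apply, hxB _ haB, star_zero])
    have h2 : a.1⁻¹ * c ∈ B := by
      by_contra haB
      exact right_ne_zero_of_mul hne (hxB _ haB)
    have hac : src a.1⁻¹ = rng c := (src_inv _).trans a.2
    -- Both factors lie in `B` and have the same range; injectivity of `rng` makes them equal, so
    -- `c` is the source of an arrow of `B`.
    have h3 : a.1⁻¹ * c = a.1⁻¹ := hrng h2 h1 (rng_mul _ _ hac)
    have h4 := inv_mul_cancel' _ _ hac
    rw [h3, inv_mul_self] at h4
    exact hc ⟨_, h1, h4⟩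

variable [LocallyCompactSpace G]

/-- Bump functions in `C_c(G)`. -/
theorem exists_convAlg_bump {K U : Set G} (hK : IsCompact K) (hU : IsOpen U) (hKU : K ⊆ U) :
    ∃ (h : G → ℝ) (k : ConvAlg G), (∀ c, k c = h c) ∧ (∀ c ∈ K, h c = 1) ∧
      (∀ c, 0 ≤ h c ∧ h c ≤ 1) ∧ IsCompact (tsupport h) ∧ tsupport h ⊆ U ∧ Continuous h := by
  obtain ⟨h, hc, hs, hsub, h1, h01⟩ := exists_bump hK hU hKU
  exact ⟨h, ConvAlg.mk (fun c => (h c : ℂ)) (Complex.continuous_ofReal.comp hc)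
    (hs.of_isClosed_subset (isClosed_tsupport _)
      (closure_mono fun c hc => by simpa using hc)), fun c => rfl, h1, h01, hs, hsub, hc⟩

/-- A compact neighbourhood version of local contraction, inside `G`. -/
theorem IsLocallyContracting.exists_compact (hG : IsLocallyContracting G) {U : Set G}
    (hU : IsOpen U) (hUu : U ⊆ unitSpace G) (hne : U.Nonempty) :
    ∃ V W B : Set G, IsOpen V ∧ V ⊆ W ∧ V ⊆ U ∧ IsCompact W ∧ IsOpen B ∧ Set.InjOn src B ∧
      Set.InjOn rng B ∧ W ⊆ src '' B ∧ rng '' (B ∩ src ⁻¹' W) ⊆ V ∧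
      (V \ rng '' (B ∩ src ⁻¹' W)).Nonempty := by
  obtain ⟨v, hv⟩ := hne
  obtain ⟨K, hK, hvK, hKU⟩ := exists_compact_subset hU hv
  obtain ⟨V, hV, hVU, B, hB, ⟨hBr, hBs⟩, hVB, hBV⟩ := hG (Subtype.val ⁻¹' interior K)
    (isOpen_interior.preimage continuous_subtype_val) ⟨⟨v, hUu hv⟩, hvK⟩
  have hW : IsCompact (closure V) := by
    have hK' : IsCompact (Subtype.val ⁻¹' K : Set (unitSpace G)) := by
      rw [Subtype.isCompact_iff, Subtype.image_preimage_coe,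
        Set.inter_eq_self_of_subset_right (hKU.trans hUu)]
      exact hK
    refine hK'.of_isClosed_subset isClosed_closure (closure_minimal ?_ hK'.isClosed)
    exact hVU.trans (Set.preimage_mono interior_subset)
  have himg : rng '' (B ∩ src ⁻¹' (Subtype.val '' closure V)) =
      Subtype.val '' (rngU '' (B ∩ srcU ⁻¹' closure V) : Set (unitSpace G)) := by
    ext c
    constructor
    · rintro ⟨b, ⟨hb, w, hw, hwb⟩, rfl⟩
      have : srcU b = w := Subtype.ext hwb.symm
      exact ⟨rngU b, ⟨b, ⟨hb, by rw [Set.mem_preimage, this]; exact hw⟩, rfl⟩, rfl⟩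
    · rintro ⟨_, ⟨b, ⟨hb, hb'⟩, rfl⟩, rfl⟩
      exact ⟨b, ⟨hb, srcU b, hb', rfl⟩, rfl⟩
  refine ⟨Subtype.val '' V, Subtype.val '' closure V, B,
    (isOpen_unitSpace G).isOpenMap_subtype_val _ hV, Set.image_mono subset_closure, ?_,
    hW.image continuous_subtype_val, hB, ?_, ?_, ?_, ?_, ?_⟩
  · rintro _ ⟨w, hw, rfl⟩
    exact hKU (interior_subset (hVU hw))
  · intro a ha b hb hab
    exact congrArg Subtype.val (@hBs.injective ⟨a, ha⟩ ⟨b, hb⟩ (Subtype.ext hab))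
  · intro a ha b hb hab
    exact congrArg Subtype.val (@hBr.injective ⟨a, ha⟩ ⟨b, hb⟩ (Subtype.ext hab))
  · rintro _ ⟨w, hw, rfl⟩
    obtain ⟨b, hb, rfl⟩ := hVB hw
    exact ⟨b, hb, rfl⟩
  · rw [himg]
    exact Set.image_mono hBV.1
  · rw [himg, ← Set.image_sdiff Subtype.val_injective]
    exact (Set.sdiff_nonempty.2 hBV.2).image _

/-- A locally contracting groupoid has nonunitary isometries supported over any nonempty open set
of units. -/
theorem IsLocallyContracting.exists_isometry (hG : IsLocallyContracting G) {U : Set G}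
    (hU : IsOpen U) (hUu : U ⊆ unitSpace G) (hne : U.Nonempty) :
    ∃ y : ConvAlg G, star y * y + y + star y = 0 ∧
      (∃ C ⊆ U, IsCompact C ∧ ∀ c, y c ≠ 0 → rng c ∈ C ∧ src c ∈ C) ∧
      ∃ D ⊆ U, IsOpen D ∧ D.Nonempty ∧
        ∀ f : ConvAlg G, (∀ c, f c ≠ 0 → c ∈ D) → star y * f = -f := by
  obtain ⟨V, W, B, hV, hVW, hVU, hW, hB, hsrc, hrng, hWB, hLV, d, hdV, hdL⟩ :=
    hG.exists_compact hU hUu hne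
  set L := rng '' (B ∩ src ⁻¹' W) with hLdef
  have hL : IsCompact L := (isCompact_inter_preimage_src hB hsrc hW hWB).image continuous_rng
  -- Properness of the contraction leaves room in `V` outside `L`; the isometry will miss the
  -- functions supported there.
  obtain ⟨N, hN, hdN, hNV⟩ := exists_compact_subset (hV.sdiff hL.isClosed)
    (show d ∈ V \ L from ⟨hdV, hdL⟩)
  obtain ⟨h, k, hkh, h1, h01, hsc, hsV, hc⟩ := exists_convAlg_bump (hL.union hN) hV
    (Set.union_subset hLV (hNV.trans Set.sdiff_subset))
  -- Chosen so that `q² = 1 - (1 - h)²`, which makes `x⋆x + (1 - k)² = 1` for the lift `x` of `q` to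
  -- `B`.
  set q : G → ℝ := fun c => √(2 * h c - h c ^ 2) with hq
  have hqc : Continuous fun c => (q c : ℂ) := by fun_prop
  have hqs : Function.support (fun c => (q c : ℂ)) ⊆ Function.support h := by
    intro c hc0 hh
    exact hc0 (by simp [hq, hh])
  have hqs' : tsupport (fun c => (q c : ℂ)) ⊆ tsupport h := closure_mono hqs
  obtain ⟨x, hx⟩ := exists_lift hB hsrc hqc (hsc.of_isClosed_subset (isClosed_tsupport _) hqs')
    ((hqs'.trans hsV).trans (hVW.trans hWB))
  have hsuppV : ∀ c, h c ≠ 0 → c ∈ V := fun c hc => hsV (subset_tsupport _ hc)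
  have hxne : ∀ c, x c ≠ 0 → c ∈ B ∧ h (src c) ≠ 0 ∧ rng c ∈ L := by
    intro c hc0
    rw [hx] at hc0
    split_ifs at hc0 with hcB
    · have h3 : h (src c) ≠ 0 := hqs hc0
      exact ⟨hcB, h3, ⟨c, ⟨hcB, hVW (hsuppV _ h3)⟩, rfl⟩⟩
    · exact absurd rfl hc0
  have hku : ∀ c, k c ≠ 0 → c ∈ unitSpace G := fun c hc => by
    rw [hkh] at hc
    exact hUu (hVU (hsuppV c (by simpa using hc)))
  have hkstar : star k = k := by
    ext c
    rw [star_apply_of_support_subset hku, hkh]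
    simp
  have hkx : k * x = x := by
    ext c
    rw [mul_apply_of_left_support_subset hku]
    by_cases hxc : x c = 0
    · rw [hxc, mul_zero]
    · rw [hkh, h1 _ (Or.inl (hxne c hxc).2.2), Complex.ofReal_one, one_mul]
  have hxk : star x * k = star x := by
    rw [← hkstar, ← star_mul, hkx]
  have hxx : star x * x = k + k - k * k := by
    ext c
    rw [star_mul_self_apply_of_bisection hsrc hrng (h := fun c => (q c : ℂ)) (fun c hc0 =>
      hWB (hVW (hsuppV c (hqs hc0)))) (fun c hcB => by rw [hx, if_neg hcB])
      (fun c hcB => by rw [hx, if_pos hcB])]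
    have e1 : (k + k - k * k) c = k c + k c - (k * k) c := rfl
    have e2 : k (rng c) * k c = k c * k c := by
      by_cases hkc : k c = 0
      · rw [hkc, mul_zero, mul_zero]
      · rw [rng_of_mem_unitSpace (hku c hkc)]
    rw [e1, mul_apply_of_left_support_subset hku, e2, hkh]
    have e3 : (0 : ℝ) ≤ 2 * h c - h c ^ 2 := by nlinarith [h01 c]
    have e4 : q c * q c = h c + h c - h c * h c := by
      rw [hq, Real.mul_self_sqrt e3]; ring
    simp only [RCLike.star_def, Complex.conj_ofReal]
    exact_mod_cast e4
  -- The isometry is `x + (1 - k)`. Its cross terms vanish since `k = 1` on `L`, which contains the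
  -- ranges of the support of `x`, so `k x = x`.
  refine ⟨x - k, ?_, ⟨tsupport h, hsV.trans hVU, hsc, fun c hc0 => ?_⟩,
    interior N, ?_, isOpen_interior, ⟨d, hdN⟩, fun f hf => ?_⟩
  · rw [star_sub, hkstar, sub_mul, mul_sub, mul_sub, hxx, hxk, hkx]
    abel
  · by_cases hxc : x c = 0
    · have h3 : k c ≠ 0 := fun h => hc0 (by
        change x c - k c = 0
        rw [h, hxc, sub_zero])
      have h4 := hku c h3
      rw [hkh] at h3
      rw [rng_of_mem_unitSpace h4, src_of_mem_unitSpace h4]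
      have h5 : c ∈ tsupport h := subset_tsupport _ (by simpa using h3)
      exact ⟨h5, h5⟩
    · obtain ⟨-, h3, h4⟩ := hxne c hxc
      refine ⟨subset_tsupport _ ?_, subset_tsupport _ h3⟩
      rw [Function.mem_support, h1 _ (Or.inl h4)]
      exact one_ne_zero
  · exact interior_subset.trans (hNV.trans (Set.sdiff_subset.trans hVU))
  · have hfV : ∀ c, f c ≠ 0 → c ∈ N := fun c hc => interior_subset (hf c hc)
    have hfu : ∀ c, f c ≠ 0 → c ∈ unitSpace G := fun c hc => hUu (hVU (hNV (hfV c hc)).1)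
    have hkf : k * f = f := by
      ext c
      rw [mul_apply_of_left_support_subset hku]
      by_cases hfc : f c = 0
      · rw [hfc, mul_zero]
      · rw [hkh, rng_of_mem_unitSpace (hfu c hfc), h1 _ (Or.inr (hfV c hfc)), Complex.ofReal_one,
          one_mul]
    have hxf : star x * f = 0 := by
      ext c
      rw [mul_apply_of_right_support_subset hfu, ConvAlg.zero_apply, ConvAlg.star_apply]
      by_contra hne
      have h3 := (hxne c⁻¹ (star_ne_zero.1 (left_ne_zero_of_mul hne))).2.2
      rw [rng_inv] at h3
      exact (hNV (hfV _ (right_ne_zero_of_mul hne))).2 h3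
    rw [star_sub, hkstar, sub_mul, hkf, hxf, zero_sub]

/-- If the interior of the isotropy consists of units, then off the unit space an element of
`C_c(G)` can be cut down to zero by passing to a smaller open set of units. -/
theorem exists_open_subset_support
    (heff : ∀ O : Set G, IsOpen O → O.Nonempty → Disjoint O (unitSpace G) → ∃ c ∈ O, src c ≠ rng c)
    (f : ConvAlg G) {U : Set G} (hU : IsOpen U) (hne : U.Nonempty) :
    ∃ W ⊆ U, IsOpen W ∧ W.Nonempty ∧
      ∀ c, f c ≠ 0 → rng c ∈ W → src c ∈ W → c ∈ unitSpace G := by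
  have hK : IsCompact (tsupport f \ unitSpace G) := f.hasCompactSupport.diff (isOpen_unitSpace G)
  have hunit : IsClosed (unitSpace G) := by
    have : unitSpace G = {c | rng c = c} :=
      Set.ext fun c => ⟨rng_of_mem_unitSpace, fun h => by
        rw [← show rng c = c from h]; exact rng_mem_unitSpace c⟩
    rw [this]
    exact isClosed_eq continuous_rng continuous_id
  -- Quantifying over all `U` inside the predicate allows unions to be treated by shrinking twice.
  have key := hK.induction_on (p := fun S => ∀ U : Set G, IsOpen U → U.Nonempty →
    ∃ W ⊆ U, IsOpen W ∧ W.Nonempty ∧ ∀ c ∈ S, rng c ∈ W → src c ∉ W)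
    (fun U hU hne => ⟨U, subset_rfl, hU, hne, by simp⟩)
    (fun s t hst ht U hU hne => by
      obtain ⟨W, h1, h2, h3, h4⟩ := ht U hU hne
      exact ⟨W, h1, h2, h3, fun c hc => h4 c (hst hc)⟩)
    (fun s t hs ht U hU hne => by
      obtain ⟨W, h1, h2, h3, h4⟩ := hs U hU hne
      obtain ⟨W', h1', h2', h3', h4'⟩ := ht W h2 h3
      refine ⟨W', h1'.trans h1, h2', h3', ?_⟩
      rintro c (hc | hc) hr hs
      · exact h4 c hc (h1' hr) (h1' hs)
      · exact h4' c hc hr hs)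
    (fun γ hγ => by
      obtain ⟨e, hγe, he⟩ := isLocalHomeomorph_src (G := G) γ
      set B := e.source ∩ (unitSpace G)ᶜ with hBdef
      have hB : IsOpen B := e.open_source.inter hunit.isOpen_compl
      have hinj : Set.InjOn src B := by
        rw [he]; exact e.injOn.mono Set.inter_subset_left
      refine ⟨B, mem_nhdsWithin_of_mem_nhds (hB.mem_nhds ⟨hγe, hγ.2⟩), fun U hU hne => ?_⟩
      set O := B ∩ (src ⁻¹' U ∩ rng ⁻¹' U) with hOdef
      have hO : IsOpen O :=
        hB.inter ((hU.preimage continuous_src).inter (hU.preimage continuous_rng))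
      rcases O.eq_empty_or_nonempty with h0 | h0
      · refine ⟨U, subset_rfl, hU, hne, fun c hc hr hs => ?_⟩
        have : c ∈ O := ⟨hc, hs, hr⟩
        rw [h0] at this
        exact this
      · obtain ⟨c, ⟨hcB, hcs, hcr⟩, hsr⟩ := heff O hO h0
          (Set.disjoint_left.2 fun c hc hcu => hc.1.2 hcu)
        -- Take `W` to be the sources of the arrows of `B` running from `U ∩ P` to `U ∩ Q`. By
        -- injectivity of `src` on `B`, an arrow of `B` starting in `W` ends in `Q`, whereas `W ⊆
        -- P`.
        obtain ⟨P, Q, hP, hQ, hcP, hcQ, hPQ⟩ := t2_separation hsr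
        set B' := B ∩ (src ⁻¹' (U ∩ P) ∩ rng ⁻¹' (U ∩ Q)) with hB'def
        have hB' : IsOpen B' := hB.inter (((hU.inter hP).preimage continuous_src).inter
          ((hU.inter hQ).preimage continuous_rng))
        refine ⟨src '' B', ?_, isLocalHomeomorph_src.isOpenMap _ hB',
          ⟨_, c, ⟨hcB, ⟨hcs, hcP⟩, hcr, hcQ⟩, rfl⟩, ?_⟩
        · rintro _ ⟨b, hb, rfl⟩
          exact hb.2.1.1
        · rintro a ha ⟨b, hb, hbr⟩ ⟨b', hb', hbs⟩
          have hab : b' = a := hinj hb'.1 ha hbs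
          subst hab
          refine Set.disjoint_left.1 hPQ hb.2.1.2 ?_
          rw [hbr]
          exact hb'.2.2.2)
  obtain ⟨W, h1, h2, h3, h4⟩ := key U hU hne
  refine ⟨W, h1, h2, h3, fun c hc hr hs => ?_⟩
  by_contra hcu
  exact h4 c ⟨subset_tsupport _ hc, hcu⟩ hr hs

end

/-! ### Infinite projections over open sets of units, and the conclusion. -/

section

variable {G : Type u} [TopologicalSpace G] [AlgGroupoid G] [EtaleGroupoid G] [T2Space G]

theorem toFullCStar_isometry {y : ConvAlg G} (hy : star y * y + y + star y = 0) :
    star (toFullCStar y) * toFullCStar y + toFullCStar y + star (toFullCStar y) = 0 := by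
  rw [← map_star, ← map_mul, ← map_add, ← map_add, hy, map_zero]

/-- The hypothesis says `(1 + y)⋆ z = 0`, so `1 - (1 + y)(1 + y)⋆` fixes `z`. -/
theorem defect_mul_of_star_mul {A : Type*} [NonUnitalCStarAlgebra A] {y z : A}
    (h : star y * z = -z) : defect y * z = z := by
  rw [defect, neg_mul, add_mul, add_mul, mul_assoc, h, mul_neg]
  abel

theorem mul_eq_self_of_support {C : Set G} {y e : ConvAlg G}
    (hy : ∀ c, y c ≠ 0 → rng c ∈ C ∧ src c ∈ C) (heu : ∀ c, e c ≠ 0 → c ∈ unitSpace G)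
    (he : ∀ c ∈ C, e c = 1) : e * y = y ∧ e * star y = star y := by
  constructor <;> ext c <;> rw [mul_apply_of_left_support_subset heu]
  · by_cases hc : y c = 0
    · rw [hc, mul_zero]
    · rw [he _ (hy c hc).1, one_mul]
  · rw [ConvAlg.star_apply]
    by_cases hc : y c⁻¹ = 0
    · rw [hc, star_zero, mul_zero]
    · have := (hy _ hc).2
      rw [src_inv] at this
      rw [he _ this, one_mul]

variable [LocallyCompactSpace G]

/-- Every nonempty open set of units supports an infinite projection. -/
theorem exists_isInfiniteProjection_over (hcontr : IsLocallyContracting G)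
    (hA : IsSimpleCStar (FullCStar G)) {W : Set G} (hW : IsOpen W) (hWu : W ⊆ unitSpace G)
    (hne : W.Nonempty) :
    ∃ (p : FullCStar G) (h : G → ℝ) (e : ConvAlg G), IsInfiniteProjection p ∧ (∀ c, e c = h c) ∧
      (∀ c, 0 ≤ h c ∧ h c ≤ 1) ∧ (∀ c, h c ≠ 0 → c ∈ W) ∧ toFullCStar e * p = p := by
  obtain ⟨y, hy, ⟨C, hCW, hC, hyC⟩, D, hDW, hD, hDne, hyD⟩ := hcontr.exists_isometry hW hWu hne
  -- The second isometry is taken over `D`, where the defect of the first acts as the identity;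
  -- hence `z` and `z⋆` are fixed by `p` on the left.
  obtain ⟨z, hz, ⟨C', hC'D, hC', hzC'⟩, D', hD'D, hD', ⟨d, hd⟩, hzD'⟩ :=
    hcontr.exists_isometry hD (hDW.trans hWu) hDne
  obtain ⟨h, e, heh, h1, h01, -, hsupp, -⟩ := exists_convAlg_bump hC hW hCW
  obtain ⟨h', e', heh', h1', -, -, hsupp', -⟩ := exists_convAlg_bump hC' hD hC'D
  obtain ⟨h'', e'', heh'', h1'', -, -, hsupp'', -⟩ :=
    exists_convAlg_bump (isCompact_singleton (x := d)) hD' (by simpa using hd)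
  have hcast : ∀ {S : Set G} {k : G → ℝ} {a : ConvAlg G}, (∀ c, a c = k c) → tsupport k ⊆ S →
      ∀ c, a c ≠ 0 → c ∈ S := fun hak hS c hc => hS (subset_tsupport _ (by
    rw [hak] at hc
    exact fun h => hc (by rw [h, Complex.ofReal_zero])))
  have heW := hcast heh hsupp
  have he'D := hcast heh' hsupp'
  have he''D' := hcast heh'' hsupp''
  have hey := mul_eq_self_of_support hyC (fun c hc => hWu (heW c hc))
    (fun c hc => by rw [heh, h1 c hc, Complex.ofReal_one])
  have hez := mul_eq_self_of_support hzC' (fun c hc => hWu (hDW (he'D c hc)))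
    (fun c hc => by rw [heh', h1' c hc, Complex.ofReal_one])
  set p := defect (toFullCStar y) with hp
  have hpD : ∀ f : ConvAlg G, (∀ c, f c ≠ 0 → c ∈ D) → p * toFullCStar f = toFullCStar f :=
    fun f hf => defect_mul_of_star_mul (by rw [← map_star, ← map_mul, hyD f hf, map_neg])
  have hpz : p * toFullCStar z = toFullCStar z := by
    rw [← hez.1, map_mul, ← mul_assoc, hpD _ he'D]
  have hpz' : p * star (toFullCStar z) = star (toFullCStar z) := by
    rw [← map_star, ← hez.2, map_mul, ← mul_assoc, hpD _ he'D]
  -- The defect of `z` fixes the nonzero bump function `e''` supported in `D'`, so it is nonzero.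
  have hz0 : defect (toFullCStar z) ≠ 0 := by
    intro h0
    have h2 : defect (toFullCStar z) * toFullCStar e'' = toFullCStar e'' :=
      defect_mul_of_star_mul (by rw [← map_star, ← map_mul, hzD' _ he''D', map_neg])
    rw [h0, zero_mul] at h2
    refine toFullCStar_ne_zero (f := e'') (fun h3 => ?_) h2.symm
    have h4 := heh'' d
    rw [h3, h1'' d rfl] at h4
    simp at h4
  refine ⟨p, h, e, isInfiniteProjection_of_isometry hA
    (isStarProjection_defect (toFullCStar_isometry hy)) (toFullCStar_isometry hz) hz0 hpz hpz',
    heh, h01, fun c hc => hsupp (subset_tsupport _ hc), ?_⟩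
  rw [hp, defect, mul_neg, mul_add, mul_add, ← mul_assoc, ← map_star, ← map_mul, ← map_mul, hey.1,
    hey.2]

/-- A simple full C⋆-algebra of a locally contracting étale groupoid is purely infinite. -/
theorem IsLocallyContracting.isPurelyInfinite (hcontr : IsLocallyContracting G)
    (hsimple : IsSimpleCStar (FullCStar G)) : IsPurelyInfinite (FullCStar G) := by
  intro B hB hB0
  obtain ⟨b, hbB, hb0⟩ : ∃ b ∈ B, b ≠ 0 := by
    by_contra! h
    refine hB0 (eq_bot_iff.2 fun x hx => ?_)
    rw [NonUnitalStarAlgebra.mem_bot]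
    exact h x hx
  obtain ⟨v, hv, η, hη, hηv⟩ := exists_unit_pos hsimple hb0
  -- The final error is `‖b⋆b - f‖ < η/4` plus `‖e(f - η)e‖ ≤ η/2`, which is below `η`.
  obtain ⟨f, hf⟩ := (denseRange_toFullCStar (G := G)).exists_dist_lt (star b * b)
    (show 0 < η / 4 by positivity)
  rw [dist_comm, dist_eq_norm] at hf
  have hU : IsOpen (unitSpace G ∩ {c | ‖f c - η‖ < η / 2}) :=
    (isOpen_unitSpace G).inter
      (isOpen_lt (f.continuous.sub continuous_const).norm continuous_const)
  obtain ⟨W, hWU, hW, hWne, hWf⟩ := exists_open_subset_support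
    (fun O hO hne hOu => exists_src_ne_rng hsimple hO hne hOu) f hU
    ⟨v, hv, (hηv f).trans_lt (hf.trans (by linarith))⟩
  obtain ⟨p, h, e, hp, heh, h01, hhW, hep⟩ := exists_isInfiniteProjection_over hcontr hsimple hW
    (hWU.trans Set.inter_subset_left) hWne
  have heW : ∀ c, e c ≠ 0 → c ∈ W := fun c hc => hhW c fun h0 => hc (by rw [heh, h0]; simp)
  have heu : ∀ c, e c ≠ 0 → c ∈ unitSpace G := fun c hc => (hWU (heW c hc)).1
  have hse : star e = e := by
    ext c
    rw [star_apply_of_support_subset heu, heh]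
    simp
  have hps : star p = p := hp.1.isSelfAdjoint
  have hpe : p * toFullCStar e = p := by
    rw [← hps, ← hse, map_star, ← star_mul, hep]
  -- This is `e(f - η)e`. By the choice of `W` it lives on the unit space, where its norm is bounded
  -- by its supremum; since `p e = p = e p`, compression by `p` gives `p f p - ηp`.
  set g : ConvAlg G := e * f * e - (η : ℂ) • (e * e) with hg
  have hgc : ∀ c, g c = e (rng c) * f c * e (src c) - η * (e (rng c) * e c) := by
    intro c
    change (e * f * e) c - (η : ℂ) * (e * e) c = _
    rw [mul_apply_of_right_support_subset heu, mul_apply_of_left_support_subset heu,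
      mul_apply_of_left_support_subset heu]
  have hgu : ∀ c, g c ≠ 0 → c ∈ unitSpace G := by
    intro c hc
    by_contra hcu
    apply hc
    have h0 : e c = 0 := by
      by_contra hne
      exact hcu (heu c hne)
    rw [hgc, h0, mul_zero, mul_zero, sub_zero]
    by_contra hne
    exact hcu (hWf c (right_ne_zero_of_mul (left_ne_zero_of_mul hne))
      (heW _ (left_ne_zero_of_mul (left_ne_zero_of_mul hne))) (heW _ (right_ne_zero_of_mul hne)))
  have hgn : ∀ c, ‖g c‖ₑ ≤ ENNReal.ofReal (η / 2) := by
    intro c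
    rw [← ofReal_norm]
    refine ENNReal.ofReal_le_ofReal ?_
    by_cases hgc0 : g c = 0
    · rw [hgc0, norm_zero]; positivity
    · have hcu := hgu c hgc0
      have hgc' : g c = e c * e c * (f c - η) := by
        rw [hgc, rng_of_mem_unitSpace hcu, src_of_mem_unitSpace hcu]; ring
      have hec : e c ≠ 0 := fun h0 => hgc0 (by rw [hgc', h0]; ring)
      have he1 : ‖e c‖ ≤ 1 := by
        rw [heh, Complex.norm_real, Real.norm_of_nonneg (h01 c).1]
        exact (h01 c).2
      rw [hgc', norm_mul, norm_mul]
      have h2 : ‖f c - η‖ < η / 2 := (hWU (heW c hec)).2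
      calc ‖e c‖ * ‖e c‖ * ‖f c - η‖ ≤ 1 * 1 * (η / 2) := by gcongr
        _ = η / 2 := by ring
  have hg2 : ‖toFullCStar g‖ ≤ η / 2 := by
    refine (norm_toFullCStar_le g).trans ?_
    exact ENNReal.toReal_le_of_le_ofReal (by positivity) (iNorm_le_of_support_subset hgu hgn)
  refine hB.exists_isInfiniteProjection hbB hp (η := η) ?_
  have hsplit : p * (star b * b) * p - η • p =
      p * (star b * b - toFullCStar f) * p + p * toFullCStar g * p := by
    have h1 : p * toFullCStar g * p = p * toFullCStar f * p - η • p := by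
      rw [hg, map_sub, map_smul, map_mul, map_mul, map_mul, mul_sub, sub_mul, mul_smul_comm,
        smul_mul_assoc, ← mul_assoc, ← mul_assoc, hpe, mul_assoc _ _ p, hep,
        ← mul_assoc p (toFullCStar e), hpe, hpe, hp.1.isIdempotentElem.eq, Complex.coe_smul]
    rw [h1, mul_sub, sub_mul]
    abel
  have hcut : ∀ a : FullCStar G, ‖p * a * p‖ ≤ ‖a‖ := fun a => by
    have h4 : ‖p‖ ≤ 1 := hp.1.norm_le
    refine (norm_mul_le _ _).trans ((mul_le_of_le_one_right (norm_nonneg _) h4).trans ?_)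
    exact (norm_mul_le _ _).trans (mul_le_of_le_one_left (norm_nonneg _) h4)
  rw [hsplit]
  calc _ ≤ ‖star b * b - toFullCStar f‖ + ‖toFullCStar g‖ :=
        (norm_add_le _ _).trans (add_le_add (hcut _) (hcut _))
    _ < η := by rw [norm_sub_rev]; linarith

end

end EtaleGpd

end

theorem corollary5p11 (G : Type u) [TopologicalSpace G] [EtaleGpd.AlgGroupoid G]
    [EtaleGpd.EtaleGroupoid G] [LocallyCompactSpace G] [T2Space G] [SecondCountableTopology G]
    (hcontr : EtaleGpd.IsLocallyContracting G)
    (hsimple : EtaleGpd.IsSimpleCStar (EtaleGpd.FullCStar G)) :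
    EtaleGpd.IsPurelyInfinite (EtaleGpd.FullCStar G) := by
  exact hcontr.isPurelyInfinite hsimple
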